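/- For $d\geq 1$ let $NF_2^d=F_2/\gamma_{d+1}(F_2)$ be the free 2-generated group in the variety of nilpotent groups of class at most $d$, with free generators $x,y$, where $F_2$ is the free group on two generators and $\gamma_1(G)=G$, $\gamma_{i+1}(G)=[\gamma_i(G),G]$ is the lower central series. A word $w=w(x,y)\in NF_2^d$ induces on the set $NF_2^d$ the binary (verbal) operation $a*b=w(a,b)$, where $w(a,b)$ is the image of $w$ under the endomorphism of $NF_2^d$ with $x\mapsto a$, $y\mapsto b$; denote by $(NF_2^d)^*$ the set $NF_2^d$ with this operation. We say that $w$ satisfies condition $\mathrm{Op}^d$ if $(NF_2^d)^*$ satisfies all the group axioms and there is an isomorphism $\sigma_d\colon NF_2^d\to (NF_2^d)^*$ with $\sigma_d(x)=x$ and $\sigma_d(y)=y$. For every $d\geq 2$ there are exactly two words $w\in NF_2^d$ that satisfy condition $\mathrm{Op}^d$, namely $w=xy$ and $w=yx$. -/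

import Mathlib

/-- `C` is a nilpotent group of class at most `d`: the `(d + 1)`-st term of its lower central
series is trivial. (The series below starts at index `0` with the whole group.) -/
def NilpotentClassLE (d : ℕ) (C : Type*) [Group C] : Prop :=
  (⊤ : Subgroup C).lowerCentralSeries d = ⊥

/-- The free `i`-generated group in the variety of nilpotent groups of class at most `d`. -/
abbrev NF (i d : ℕ) : Type :=
  FreeGroup (Fin i) ⧸ (⊤ : Subgroup (FreeGroup (Fin i))).lowerCentralSeries d

namespace NF

/-- The free generators of `NF i d`. -/
def gen (i d : ℕ) (k : Fin i) : NF i d := QuotientGroup.mk (FreeGroup.of k)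

/-- `NF i d` is itself nilpotent of class at most `d`. -/
theorem nilpotentClassLE (i d : ℕ) : NilpotentClassLE d (NF i d) := by
  unfold NilpotentClassLE
  have hs := QuotientGroup.mk'_surjective
    ((⊤ : Subgroup (FreeGroup (Fin i))).lowerCentralSeries d)
  rw [← Subgroup.map_top_of_surjective _ hs, ← Subgroup.map_lowerCentralSeries,
    QuotientGroup.map_mk'_self]

/-- The homomorphism from `NF i d` to a nilpotent group `C` of class at most `d` which sends the
`k`-th free generator to `c k`. -/
def lift {i d : ℕ} {C : Type*} [Group C] (hC : NilpotentClassLE d C) (c : Fin i → C) :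
    NF i d →* C :=
  QuotientGroup.lift _ (FreeGroup.lift c) (by
    intro g hg
    have h := Subgroup.mem_map_of_mem (FreeGroup.lift c) hg
    rw [Subgroup.map_lowerCentralSeries] at h
    have h' : (FreeGroup.lift c) g ∈ (⊤ : Subgroup C).lowerCentralSeries d := by
      have mono : ∀ n, ((⊤ : Subgroup (FreeGroup (Fin i))).map
          (FreeGroup.lift c)).lowerCentralSeries n ≤ (⊤ : Subgroup C).lowerCentralSeries n := by
        intro n
        induction n with
        | zero => exact le_top
        | succ n ih => exact Subgroup.commutator_mono ih le_top
      exact mono d h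
    rw [show (⊤ : Subgroup C).lowerCentralSeries d = ⊥ from hC] at h'
    exact Subgroup.mem_bot.mp h')

theorem lift_gen {i d : ℕ} {C : Type*} [Group C] (hC : NilpotentClassLE d C) (c : Fin i → C)
    (k : Fin i) : lift hC c (gen i d k) = c k := by
  exact (QuotientGroup.lift_mk _ _ _).trans (FreeGroup.lift_apply_of ..)

end NF

/-- The verbal operation induced by the word `w ∈ NF k d` on a nilpotent group `C` of class at
most `d`: the value at `c` is `w(c)`, the image of `w` under the homomorphism which sends the free
generators to the entries of `c`. -/
def verbalOp {k d : ℕ} (w : NF k d) {C : Type*} [Group C] (hC : NilpotentClassLE d C)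
    (c : Fin k → C) : C :=
  NF.lift hC c w

/-- The binary verbal operation induced on `NF 2 d` by the word `w ∈ NF 2 d`. -/
def starOp {d : ℕ} (w a b : NF 2 d) : NF 2 d :=
  verbalOp w (NF.nilpotentClassLE 2 d) ![a, b]

/-- The binary operation `op` on `G` fulfills the group axioms. -/
structure IsGroupOperation {G : Type*} (op : G → G → G) : Prop where
  assoc : ∀ a b c, op (op a b) c = op a (op b c)
  exists_unit_inv : ∃ e, (∀ a, op e a = a ∧ op a e = a) ∧ ∀ a, ∃ b, op b a = e ∧ op a b = e

/-- Condition `Op^d` for a word `w ∈ NF 2 d`: the induced operation fulfills the group axioms, and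
there is an isomorphism from `NF 2 d` to `NF 2 d` with the induced operation which fixes both free
generators. -/
structure ConditionOp (d : ℕ) (w : NF 2 d) : Prop where
  isGroup : IsGroupOperation (starOp w)
  exists_iso : ∃ σ : NF 2 d ≃ NF 2 d,
    (∀ a b, σ (a * b) = starOp w (σ a) (σ b)) ∧
    σ (NF.gen 2 d 0) = NF.gen 2 d 0 ∧ σ (NF.gen 2 d 1) = NF.gen 2 d 1

open scoped commutatorElement

/-! A neutral element forces w = x y modulo γ_2, so w = x y [x, y]^k s with s in γ_3. The
isomorphism σ restricts k: in the integral Heisenberg group, a suitable quadratic expression in the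
coordinates of the image of σ(g) is additive in g modulo 2k + 1 and vanishes on the generators,
hence everywhere; but it equals 1 at the preimage of [x, y]. So 2k + 1 = ±1
(`ConditionOp.exponent_eq`). Exchanging the variables passes to the opposite operation and turns k =
-1 into k = 0.

For k = 0, associativity alone gives s = 1, one class at a time. If s lies in γ_m with m ≥ 3, then
in class m the values s(a, b) are central and depend only on a, b modulo γ_2, and associativity of a
b s(a, b) says that s is a 2-cocycle. It vanishes on the diagonal and is multiplied by 2^m when both
arguments are squared. Its antisymmetrization is biadditive, so it is multiplied by 4 as well and
must vanish; a symmetric cocycle of this kind is multiplied by 2 and must vanish too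
(`cocycle_eq_zero_of_homogeneous`, `eq_one_of_assoc`).

These cancellations need γ_m/γ_{m+1} of the free group to be torsion-free, which takes up the larger
part of the proof. Standard commutators of Lyndon words generate this quotient
(`FreeMagma.stdSpan_eq_weightSeries`), and in the Magnus expansion each of them has its own word as
least monomial of lowest degree, with coefficient 1. By triangularity the integer coefficients of
degree m, which are additive on γ_m, detect γ_{m+1} (`Magnus.mem_weightSeries_succ_of_pow_mem`). -/

/-! ### Lexicographic order and concatenation. -/

theorem List.exists_eq_append_or_forall_append_lt {α : Type*} [LinearOrder α] {u v : List α}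
    (h : u < v) : (∃ x, x ≠ [] ∧ v = u ++ x) ∨ ∀ x, u ++ x < v := by
  induction u generalizing v with
  | nil =>
    refine Or.inl ⟨v, ?_, rfl⟩
    rintro rfl
    exact lt_irrefl _ h
  | cons a u ih =>
    cases v with
    | nil => exact absurd h (List.not_lt_nil _)
    | cons b v =>
      rcases List.cons_lt_cons_iff.mp h with h | ⟨rfl, h'⟩
      · exact Or.inr fun x => List.cons_lt_cons_iff.mpr (Or.inl h)
      · rcases ih h' with ⟨x, hx, rfl⟩ | h
        · exact Or.inl ⟨x, hx, rfl⟩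
        · exact Or.inr fun x => List.cons_lt_cons_iff.mpr (Or.inr ⟨rfl, h x⟩)

theorem List.not_append_lt_self {α : Type*} [LinearOrder α] (u v : List α) : ¬ u ++ v < u := by
  induction u with
  | nil => exact List.not_lt_nil _
  | cons a u ih => simpa [List.cons_lt_cons_iff] using ih

theorem List.append_lt_append_of_length_eq {α : Type*} [LinearOrder α] {u u' v v' : List α}
    (hl : u.length = u'.length) (h : u ++ v < u' ++ v') : u < u' ∨ u = u' ∧ v < v' := by
  induction u generalizing u' with
  | nil =>
    obtain rfl : u' = [] := List.length_eq_zero_iff.mp hl.symm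
    exact Or.inr ⟨rfl, h⟩
  | cons a u ih =>
    cases u' with
    | nil => simp at hl
    | cons b u' =>
      rcases List.cons_lt_cons_iff.mp h with h | ⟨rfl, h'⟩
      · exact Or.inl (List.cons_lt_cons_iff.mpr (Or.inl h))
      · rcases ih (by simpa using hl) h' with h | ⟨rfl, hv⟩
        · exact Or.inl (List.cons_lt_cons_iff.mpr (Or.inr ⟨rfl, h⟩))
        · exact Or.inr ⟨rfl, hv⟩

/-! ### Standard bracketings of Lyndon words. -/

namespace FreeMagma

variable {α : Type*}

/-- The word obtained from a bracketing by forgetting the brackets. -/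
def word : FreeMagma α → List α
  | .of a => [a]
  | .mul s t => word s ++ word t

@[simp] theorem word_of (a : α) : (FreeMagma.of a).word = [a] := rfl

@[simp] theorem word_mul (s t : FreeMagma α) : (FreeMagma.mul s t).word = s.word ++ t.word := rfl

theorem word_ne_nil (t : FreeMagma α) : t.word ≠ [] := by
  induction t using FreeMagma.rec with
  | of a => simp
  | mul s t hs ht => exact fun h => hs (List.append_eq_nil_iff.mp h).1

theorem word_length_pos (t : FreeMagma α) : 0 < t.word.length :=
  List.length_pos_iff.mpr t.word_ne_nil

variable [LinearOrder α]

/-- The standard bracketings of Lyndon words. -/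
def IsStd : FreeMagma α → Prop
  | .of _ => True
  | .mul (.of a) t => IsStd t ∧ [a] < word t
  | .mul (.mul r s) t =>
    IsStd (.mul r s) ∧ IsStd t ∧ word (.mul r s) < word t ∧ ¬ word s < word t

theorem IsStd.left {s t : FreeMagma α} (h : IsStd (.mul s t)) : IsStd s := by
  cases s with
  | of a => trivial
  | mul r s => exact h.1

theorem IsStd.right {s t : FreeMagma α} (h : IsStd (.mul s t)) : IsStd t := by
  cases s with
  | of a => exact h.1
  | mul r s => exact h.2.1

theorem IsStd.lt {s t : FreeMagma α} (h : IsStd (.mul s t)) : s.word < t.word := by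
  cases s with
  | of a => exact h.2
  | mul r s => exact h.2.2.1

/-- The word of a standard bracketing is smaller than its proper suffixes, and the second factor is
the least of these suffixes. -/
theorem IsStd.lt_suffix_and_least {T : FreeMagma α} (hT : IsStd T) :
    (∀ y z, y ≠ [] → z ≠ [] → T.word = y ++ z → T.word < z) ∧
    ∀ s t, T = .mul s t → ∀ y z, y ≠ [] → z ≠ [] → T.word = y ++ z → ¬ z < t.word := by
  induction T using FreeMagma.rec with
  | of a =>
    have key : ∀ y z : List α, y ≠ [] → z ≠ [] → [a] = y ++ z → False := by
      intro y z hy hz h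
      have := congrArg List.length h
      have := List.length_pos_iff.mpr hy
      have := List.length_pos_iff.mpr hz
      simp at *
      omega
    exact ⟨fun y z hy hz h => (key y z hy hz h).elim,
      fun s t _ y z hy hz h => (key y z hy hz h).elim⟩
  | mul s t ihs iht =>
    have ihs := ihs hT.left
    have iht := iht hT.right
    have least : ∀ y z, y ≠ [] → z ≠ [] → s.word ++ t.word = y ++ z → ¬ z < t.word := by
      intro y z hy hz h
      rcases List.append_eq_append_iff.mp h with ⟨x, rfl, h'⟩ | ⟨x, h', rfl⟩
      · rcases eq_or_ne x [] with rfl | hx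
        · rw [h', List.nil_append]
          exact lt_irrefl _
        · exact (iht.1 x z hx hz h').not_gt
      · rcases eq_or_ne x [] with rfl | hx
        · exact lt_irrefl _
        · cases s with
          | of a =>
            have := congrArg List.length h'
            have := List.length_pos_iff.mpr hy
            have := List.length_pos_iff.mpr hx
            simp at *
            omega
          | mul r q =>
            -- The suffix starts inside the left factor (r, q), so it is x followed by the word of
            -- t; then t ≤ q by standardness, q ≤ x by leastness in the left factor, and x ≤ x t.
            have h1 := ihs.2 r q rfl y x hy hx h'
            have h2 : ¬ q.word < t.word := hT.2.2.2
            have h3 := List.not_append_lt_self x t.word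
            rw [not_lt] at *
            exact (h2.trans h1).trans h3
    refine ⟨fun y z hy hz h => ?_, fun s' t' h => ?_⟩
    · have h1 : s.word ++ t.word < t.word := by
        -- If s is a proper prefix of t, say t = s x, then t < x because x is a proper suffix of t,
        -- and prefixing s gives s t < s x = t. Otherwise s and t already differ at a letter and
        -- appending to s changes nothing.
        rcases List.exists_eq_append_or_forall_append_lt hT.lt with ⟨x, hx, h'⟩ | h'
        · have := iht.1 _ _ s.word_ne_nil hx h'
          conv_rhs => rw [h']
          exact List.append_left_lt this
        · exact h' _
      exact h1.trans_le (not_lt.mp (least y z hy hz h))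
    · cases h
      exact least

theorem IsStd.word_append_lt {s t : FreeMagma α} (h : IsStd (.mul s t)) :
    s.word ++ t.word < t.word :=
  h.lt_suffix_and_least.1 _ _ s.word_ne_nil t.word_ne_nil rfl

theorem IsStd.word_append_lt_swap {s t : FreeMagma α} (h : IsStd (.mul s t)) :
    s.word ++ t.word < t.word ++ s.word :=
  h.word_append_lt.trans_le (not_lt.mp (List.not_append_lt_self _ _))

/-- A standard bracketing is determined by its word. -/
theorem IsStd.word_injective {S T : FreeMagma α} (hS : IsStd S) (hT : IsStd T)
    (h : S.word = T.word) : S = T := by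
  induction S using FreeMagma.rec generalizing T with
  | of a =>
    cases T with
    | of b => exact congrArg _ (List.singleton_inj.mp h)
    | mul s t =>
      have := congrArg List.length h
      have := s.word_length_pos
      have := t.word_length_pos
      simp only [word_of, word_mul, List.length_append, List.length_singleton] at *
      omega
  | mul s t ihs iht =>
    cases T with
    | of b =>
      have := congrArg List.length h
      have := s.word_length_pos
      have := t.word_length_pos
      simp only [word_of, word_mul, List.length_append, List.length_singleton] at *
      omega
    | mul s' t' =>
      -- Both right factors are the least proper suffix of the same word, so they coincide.
      have h1 := hS.lt_suffix_and_least.2 s t rfl _ _ s'.word_ne_nil t'.word_ne_nil h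
      have h2 := hT.lt_suffix_and_least.2 s' t' rfl _ _ s.word_ne_nil t.word_ne_nil h.symm
      have ht : t.word = t'.word := le_antisymm (not_lt.mp h1) (not_lt.mp h2)
      have hs : s.word = s'.word := by
        simp only [word_mul, ht] at h
        exact List.append_cancel_right h
      rw [ihs hS.left hT.left hs, iht hS.right hT.right ht]

end FreeMagma

/-! ### Commutator calculus modulo terms of higher weight. -/

namespace Subgroup

/-- The lower central series of `G`, indexed by weight: `weightSeries G n = γ_n(G)` for `1 ≤ n`, and
`weightSeries G 0 = G`. -/
def weightSeries (G : Type*) [Group G] (n : ℕ) : Subgroup G :=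
  (⊤ : Subgroup G).lowerCentralSeries (n - 1)

variable {G H : Type*} [Group G] [Group H]

instance weightSeries_normal (n : ℕ) : (weightSeries G n).Normal :=
  lowerCentralSeries_normal _ _

@[simp] theorem weightSeries_one : weightSeries G 1 = ⊤ := rfl

theorem weightSeries_succ (n : ℕ) (hn : 1 ≤ n) :
    weightSeries G (n + 1) = ⁅weightSeries G n, (⊤ : Subgroup G)⁆ := by
  obtain ⟨m, rfl⟩ := Nat.exists_eq_add_of_le' hn
  rfl

theorem weightSeries_antitone : Antitone (weightSeries G) := fun _ _ h =>
  lowerCentralSeries_antitone _ (Nat.sub_le_sub_right h 1)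

theorem map_weightSeries_le (f : G →* H) (n : ℕ) :
    (weightSeries G n).map f ≤ weightSeries H n := by
  rw [weightSeries, map_lowerCentralSeries]
  exact lowerCentralSeries_mono _ le_top

theorem map_mem_weightSeries (f : G →* H) {n : ℕ} {g : G} (hg : g ∈ weightSeries G n) :
    f g ∈ weightSeries H n :=
  map_weightSeries_le f n (mem_map_of_mem f hg)

theorem map_weightSeries_of_surjective (f : G →* H) (hf : Function.Surjective f) (n : ℕ) :
    (weightSeries G n).map f = weightSeries H n := by
  rw [weightSeries, map_lowerCentralSeries, map_top_of_surjective f hf, weightSeries]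

/-- The three subgroups lemma, applied in the quotient by N. -/
theorem commutator_commutator_le_of_rotate {A B C N : Subgroup G} [N.Normal]
    (h1 : ⁅⁅B, C⁆, A⁆ ≤ N) (h2 : ⁅⁅C, A⁆, B⁆ ≤ N) : ⁅⁅A, B⁆, C⁆ ≤ N := by
  have key : ∀ K : Subgroup G, K ≤ N ↔ K.map (QuotientGroup.mk' N) = ⊥ := fun K => by
    rw [map_eq_bot_iff, QuotientGroup.ker_mk']
  rw [key] at *
  simp only [map_commutator] at *
  exact commutator_commutator_eq_bot_of_rotate h1 h2

/-- Induction on n by the three subgroups lemma. Index m stands for γ_{m+1}, which explains the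
extra 1: this is [γ_i, γ_j] ≤ γ_{i+j}. -/
theorem commutator_lowerCentralSeries_le (m n : ℕ) :
    ⁅(⊤ : Subgroup G).lowerCentralSeries m, (⊤ : Subgroup G).lowerCentralSeries n⁆ ≤
      (⊤ : Subgroup G).lowerCentralSeries (m + n + 1) := by
  induction n generalizing m with
  | zero => exact le_rfl
  | succ n ih =>
    rw [commutator_comm, lowerCentralSeries_succ]
    apply commutator_commutator_le_of_rotate
    · rw [commutator_comm ⊤, ← lowerCentralSeries_succ]
      exact (ih (m + 1)).trans (lowerCentralSeries_antitone _ (by omega))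
    · refine (commutator_mono (ih m) le_rfl).trans (le_of_eq ?_)
      rw [← lowerCentralSeries_succ, add_assoc m n 1]

theorem commutator_weightSeries_le (m n : ℕ) :
    ⁅weightSeries G m, weightSeries G n⁆ ≤ weightSeries G (m + n) := by
  rcases Nat.eq_zero_or_pos m with rfl | hm
  · rw [zero_add]
    exact commutator_le_right _ _
  rcases Nat.eq_zero_or_pos n with rfl | hn
  · exact commutator_le_left _ _
  · exact (commutator_lowerCentralSeries_le _ _).trans (lowerCentralSeries_antitone _ (by omega))

theorem commutator_mem_weightSeries {m n : ℕ} {g h : G} (hg : g ∈ weightSeries G m)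
    (hh : h ∈ weightSeries G n) : ⁅g, h⁆ ∈ weightSeries G (m + n) :=
  commutator_weightSeries_le m n (commutator_mem_commutator hg hh)

theorem commute_mk_of_mem_weightSeries {n : ℕ} {z : G} (hz : z ∈ weightSeries G n) (g : G) :
    Commute (g : G ⧸ weightSeries G (n + 1)) z := by
  rw [← commutatorElement_eq_one_iff_commute, ← commutatorElement_inv, inv_eq_one]
  refine (QuotientGroup.eq_one_iff ⁅z, g⁆).mpr ?_
  exact commutator_mem_weightSeries hz (n := 1) (mem_top g)

/-- The exact formula has ⁅b, c⁆ conjugated by a, and ⁅b, c⁆ is central modulo the next weight;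
hence a needs no weight. -/
theorem mk_commutator_mul_left (a : G) {b c : G} {i j : ℕ} (hb : b ∈ weightSeries G i)
    (hc : c ∈ weightSeries G j) :
    ((⁅a * b, c⁆ : G) : G ⧸ weightSeries G (i + j + 1)) = (⁅a, c⁆ * ⁅b, c⁆ : G) := by
  have h := commute_mk_of_mem_weightSeries (commutator_mem_weightSeries hb hc)
  rw [commutatorElement_mul_left_eq_conj_mul]
  simp only [QuotientGroup.mk_mul, QuotientGroup.mk_inv]
  rw [(h a).eq, mul_inv_cancel_right, (h _).eq]

theorem mk_commutator_mul_right (b : G) {a c : G} {i j : ℕ} (ha : a ∈ weightSeries G i)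
    (hc : c ∈ weightSeries G j) :
    ((⁅a, b * c⁆ : G) : G ⧸ weightSeries G (i + j + 1)) = (⁅a, b⁆ * ⁅a, c⁆ : G) := by
  have h := commute_mk_of_mem_weightSeries (commutator_mem_weightSeries ha hc)
  rw [commutatorElement_mul_right_eq_mul_conj]
  simp only [QuotientGroup.mk_mul, QuotientGroup.mk_inv]
  rw [mul_assoc (QuotientGroup.mk ⁅a, b⁆), (h b).eq, ← mul_assoc, mul_inv_cancel_right]

/-- Changing an argument by an element of higher weight changes the commutator by one of higher
weight: the bracket is well defined on the associated graded group. -/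
theorem mk_commutator_congr {a a' b b' : G} {i j : ℕ} (ha : a ∈ weightSeries G i)
    (hb : b ∈ weightSeries G j) (haa : (a : G ⧸ weightSeries G (i + 1)) = a')
    (hbb : (b : G ⧸ weightSeries G (j + 1)) = b') :
    ((⁅a, b⁆ : G) : G ⧸ weightSeries G (i + j + 1)) = (⁅a', b'⁆ : G) := by
  obtain ⟨r, hr, rfl⟩ : ∃ r ∈ weightSeries G (i + 1), a' = a * r :=
    ⟨a⁻¹ * a', QuotientGroup.eq.mp haa, by group⟩
  obtain ⟨s, hs, rfl⟩ : ∃ s ∈ weightSeries G (j + 1), b' = b * s :=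
    ⟨b⁻¹ * b', QuotientGroup.eq.mp hbb, by group⟩
  have hr' := weightSeries_antitone (Nat.le_succ i) hr
  have hs' := weightSeries_antitone (Nat.le_succ j) hs
  rw [mk_commutator_mul_left a hr' (mul_mem hb hs'), QuotientGroup.mk_mul,
    mk_commutator_mul_right b ha hs', QuotientGroup.mk_mul]
  have h1 : ((⁅a, s⁆ : G) : G ⧸ weightSeries G (i + j + 1)) = 1 :=
    (QuotientGroup.eq_one_iff _).mpr (commutator_mem_weightSeries (m := i) (n := j + 1) ha hs)
  have h2 : ((⁅r, b * s⁆ : G) : G ⧸ weightSeries G (i + j + 1)) = 1 := by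
    refine (QuotientGroup.eq_one_iff _).mpr ?_
    have := commutator_mem_weightSeries hr (mul_mem hb hs')
    rwa [add_right_comm] at this
  rw [h1, h2, mul_one, mul_one]

theorem mk_commutator_pow_left {a b : G} {i j : ℕ} (ha : a ∈ weightSeries G i)
    (hb : b ∈ weightSeries G j) (k : ℕ) :
    ((⁅a ^ k, b⁆ : G) : G ⧸ weightSeries G (i + j + 1)) = (⁅a, b⁆ ^ k : G) := by
  induction k with
  | zero => simp
  | succ k ih =>
    rw [pow_succ, mk_commutator_mul_left _ ha hb, QuotientGroup.mk_mul, ih, pow_succ,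
      QuotientGroup.mk_mul]

theorem mk_commutator_pow_right {a b : G} {i j : ℕ} (ha : a ∈ weightSeries G i)
    (hb : b ∈ weightSeries G j) (k : ℕ) :
    ((⁅a, b ^ k⁆ : G) : G ⧸ weightSeries G (i + j + 1)) = (⁅a, b⁆ ^ k : G) := by
  induction k with
  | zero => simp
  | succ k ih =>
    rw [pow_succ, mk_commutator_mul_right _ ha hb, QuotientGroup.mk_mul, ih, pow_succ,
      QuotientGroup.mk_mul]

/-- Conjugation by b contributes the factor ⁅x, ⁅b, c⁆⁆ of weight l + j + k, which is negligible
since j ≥ 1. This removes the conjugates from the Hall–Witt identity. -/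
theorem mk_commutator_conj_right {x c b : G} {l j k : ℕ} (hx : x ∈ weightSeries G l)
    (hb : b ∈ weightSeries G j) (hc : c ∈ weightSeries G k) (hj : 1 ≤ j) :
    ((⁅x, b * c * b⁻¹⁆ : G) : G ⧸ weightSeries G (l + k + 1)) = (⁅x, c⁆ : G) := by
  have h : b * c * b⁻¹ = ⁅b, c⁆ * c := by simp [commutatorElement_def]
  rw [h, mk_commutator_mul_right _ hx hc, QuotientGroup.mk_mul]
  have h1 : ((⁅x, ⁅b, c⁆⁆ : G) : G ⧸ weightSeries G (l + k + 1)) = 1 :=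
    (QuotientGroup.eq_one_iff _).mpr (weightSeries_antitone (by omega)
      (commutator_mem_weightSeries hx (commutator_mem_weightSeries hb hc)))
  rw [h1, one_mul]

/-- The Jacobi identity for commutators, modulo terms of higher weight. -/
theorem mk_commutator_jacobi {a b c : G} {i j k : ℕ} (ha : a ∈ weightSeries G i)
    (hb : b ∈ weightSeries G j) (hc : c ∈ weightSeries G k) (hi : 1 ≤ i) (hj : 1 ≤ j)
    (hk : 1 ≤ k) :
    ((⁅⁅a, b⁆, c⁆ * ⁅⁅b, c⁆, a⁆ * ⁅⁅c, a⁆, b⁆ : G) : G ⧸ weightSeries G (i + j + k + 1)) = 1 := by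
  have h1 := mk_commutator_conj_right (commutator_mem_weightSeries ha hb) hb hc hj
  have h2 := mk_commutator_conj_right (commutator_mem_weightSeries hb hc) hc ha hk
  have h3 := mk_commutator_conj_right (commutator_mem_weightSeries hc ha) ha hb hi
  rw [show j + k + i = i + j + k by omega] at h2
  rw [show k + i + j = i + j + k by omega] at h3
  simp only [QuotientGroup.mk_mul]
  -- With the conjugates inserted, the product is the Hall–Witt expression, which is exactly 1.
  rw [← h1, ← h2, ← h3]
  simp only [← QuotientGroup.mk_mul]
  rw [commutatorElement_commutatorElement_conj_mul]
  rfl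

theorem mem_of_mk_eq {N T : Subgroup G} (h : N ≤ T) {a b : G} (hab : (a : G ⧸ N) = b)
    (hb : b ∈ T) : a ∈ T :=
  (mul_mem_cancel_right (h (QuotientGroup.eq.mp hab))).mp (by simpa)

/-- Bracketing with a fixed h is additive on γ_i modulo γ_{i+j+1}, so testing it on generators
suffices. -/
theorem commutator_mem_of_closure {S : Set G} {T : Subgroup G} {g h : G} {i j : ℕ}
    (hS : S ⊆ weightSeries G i) (hg : g ∈ closure S ⊔ weightSeries G (i + 1))
    (hh : h ∈ weightSeries G j) (hT : weightSeries G (i + j + 1) ≤ T)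
    (hST : ∀ s ∈ S, ⁅s, h⁆ ∈ T) : ⁅g, h⁆ ∈ T := by
  obtain ⟨u, hu, v, hv, rfl⟩ := mem_sup_of_normal_right.mp hg
  have hu' : u ∈ weightSeries G i := (closure_le _).mpr hS hu
  have hv' : v ∈ weightSeries G i := weightSeries_antitone (Nat.le_succ i) hv
  clear hg
  refine mem_of_mk_eq hT (mk_commutator_mul_left u hv' hh) (mul_mem ?_ (hT ?_))
  · induction hu using closure_induction with
    | mem x hx => exact hST x hx
    | one => simp
    | mul x y hx hy ihx ihy =>
      have hx' : x ∈ weightSeries G i := (closure_le _).mpr hS hx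
      have hy' : y ∈ weightSeries G i := (closure_le _).mpr hS hy
      exact mem_of_mk_eq hT (mk_commutator_mul_left x hy' hh) (mul_mem (ihx hx')
        (ihy hy'))
    | inv x hx ihx =>
      have hx' : x ∈ weightSeries G i := (closure_le _).mpr hS hx
      have h1 := mk_commutator_mul_left x⁻¹ hx' hh
      rw [inv_mul_cancel, commutatorElement_one_left] at h1
      have h2 := mem_of_mk_eq hT h1.symm (one_mem T)
      exact (mul_mem_cancel_right (ihx hx')).mp h2
  · have := commutator_mem_weightSeries hv hh
    rwa [add_right_comm] at this

/-- If `f'` agrees with the `k`-th power of `f` modulo commutators, then on elements of weight `m`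
it agrees with the `k ^ m`-th power of `f` modulo elements of weight `m + 1`. -/
theorem mk_map_eq_pow (f f' : G →* H) (k : ℕ)
    (h : ∀ g, (f' g : H ⧸ weightSeries H 2) = (f g ^ k : H)) {m : ℕ} (hm : 1 ≤ m) {g : G}
    (hg : g ∈ weightSeries G m) :
    (f' g : H ⧸ weightSeries H (m + 1)) = (f g ^ k ^ m : H) := by
  induction m, hm using Nat.le_induction generalizing g with
  | base => simpa using h g
  | succ m hm ih =>
    rw [weightSeries_succ m hm, commutator_def] at hg
    have mem : ∀ x ∈ closure {g | ∃ g₁ ∈ weightSeries G m, ∃ g₂ ∈ (⊤ : Subgroup G), ⁅g₁, g₂⁆ = g},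
        x ∈ weightSeries G (m + 1) := fun x hx => by
      rwa [weightSeries_succ m hm, commutator_def]
    induction hg using closure_induction with
    | mem x hx =>
      obtain ⟨p, hp, q, -, rfl⟩ := hx
      have hfp := map_mem_weightSeries f hp
      have hfp' := map_mem_weightSeries f' hp
      have hq : ∀ x : H, x ∈ weightSeries H 1 := fun x => mem_top x
      rw [map_commutatorElement, map_commutatorElement,
        mk_commutator_congr hfp' (hq _) (ih hp) (h q),
        mk_commutator_pow_left hfp (hq _), QuotientGroup.mk_pow,
        mk_commutator_pow_right hfp (hq _), ← QuotientGroup.mk_pow, ← pow_mul, pow_succ, mul_comm]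
    | one => simp
    | mul x y hx hy ihx ihy =>
      have := commute_mk_of_mem_weightSeries (map_mem_weightSeries f (mem y hy)) (f x)
      rw [map_mul, map_mul, QuotientGroup.mk_mul, ihx, ihy,
        QuotientGroup.mk_pow, QuotientGroup.mk_pow, QuotientGroup.mk_pow, QuotientGroup.mk_mul,
        this.mul_pow]
    | inv x hx ihx =>
      rw [map_inv, map_inv, QuotientGroup.mk_inv, ihx, inv_pow, QuotientGroup.mk_inv]

end Subgroup

/-! ### Standard commutators generate γ_n modulo γ_{n+1}. -/

namespace FreeMagma

open Subgroup

variable {α G : Type*} [Group G]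

/-- The iterated commutator prescribed by a bracketing. -/
def commutatorAt (g : α → G) : FreeMagma α → G
  | .of a => g a
  | .mul s t => ⁅commutatorAt g s, commutatorAt g t⁆

theorem commutatorAt_mem_weightSeries (g : α → G) (t : FreeMagma α) :
    commutatorAt g t ∈ weightSeries G t.word.length := by
  induction t using FreeMagma.rec with
  | of a => exact mem_top _
  | mul s t hs ht =>
    rw [word_mul, List.length_append]
    exact commutator_mem_weightSeries hs ht

variable [LinearOrder α]

/-- The values of the standard commutators of weight `n` whose words satisfy `P`. -/
def stdCommutators (g : α → G) (n : ℕ) (P : List α → Prop) : Set G :=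
  {x | ∃ r : FreeMagma α, r.IsStd ∧ r.word.length = n ∧ P r.word ∧ commutatorAt g r = x}

theorem stdCommutators_subset (g : α → G) (n : ℕ) (P : List α → Prop) :
    stdCommutators g n P ⊆ weightSeries G n := by
  rintro _ ⟨r, -, rfl, -, rfl⟩
  exact commutatorAt_mem_weightSeries g r

/-- The subgroup generated by the standard commutators of weight `n` whose words satisfy `P` and by
all elements of larger weight. -/
def stdSpan (g : α → G) (n : ℕ) (P : List α → Prop) : Subgroup G :=
  closure (stdCommutators g n P) ⊔ weightSeries G (n + 1)

theorem stdSpan_mono (g : α → G) (n : ℕ) {P Q : List α → Prop} (h : ∀ w, P w → Q w) :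
    stdSpan g n P ≤ stdSpan g n Q := by
  refine sup_le_sup_right (Subgroup.closure_mono ?_) _
  rintro _ ⟨r, hr, hn, hP, rfl⟩
  exact ⟨r, hr, hn, h _ hP, rfl⟩

theorem weightSeries_le_stdSpan (g : α → G) (n : ℕ) (P : List α → Prop) :
    weightSeries G (n + 1) ≤ stdSpan g n P := le_sup_right

theorem stdSpan_le (g : α → G) (n : ℕ) (P : List α → Prop) :
    stdSpan g n P ≤ weightSeries G n :=
  sup_le ((closure_le _).mpr (stdCommutators_subset g n P)) (weightSeries_antitone (Nat.le_succ n))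

theorem commutatorAt_mem_stdSpan (g : α → G) {t : FreeMagma α} (ht : t.IsStd) {P : List α → Prop}
    (hP : P t.word) : commutatorAt g t ∈ stdSpan g t.word.length P :=
  mem_sup_left (subset_closure ⟨t, ht, rfl, hP, rfl⟩)

/-- The commutator of two standard commutators is a combination of standard commutators. -/
theorem commutator_mem_stdSpan [Finite α] (g : α → G) (n : ℕ) : ∀ s t : FreeMagma α, s.IsStd →
    t.IsStd → s.word.length + t.word.length = n → s.word < t.word →
    ⁅commutatorAt g s, commutatorAt g t⁆ ∈ stdSpan g n (· < t.word) := by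
  induction n using Nat.strong_induction_on with
  | _ n ihn =>
  -- Inside the induction on the weight there is an induction on the larger word v. Words of length
  -- at most n form a finite set, so the lexicographic order is well-founded there.
  suffices H : ∀ v ∈ {l : List α | l.length ≤ n}, ∀ s t : FreeMagma α, s.IsStd → t.IsStd →
      s.word.length + t.word.length = n → s.word < t.word → t.word = v →
      ⁅commutatorAt g s, commutatorAt g t⁆ ∈ stdSpan g n (· < v) by
    intro s t hs ht hn hlt
    exact H t.word (by simp only [Set.mem_ofPred_eq]; omega) s t hs ht hn hlt rfl
  intro v hv
  refine ((List.finite_length_le α n).wellFoundedOn (r := (· < ·))).induction hv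
    (P := fun v => ∀ s t : FreeMagma α, s.IsStd → t.IsStd →
      s.word.length + t.word.length = n → s.word < t.word → t.word = v →
      ⁅commutatorAt g s, commutatorAt g t⁆ ∈ stdSpan g n (· < v)) ?_
  clear hv v
  rintro _ - ihv s t hs ht hn hlt rfl
  have small : ∀ p q : FreeMagma α, p.IsStd → q.IsStd → p.word.length + q.word.length = n →
      p.word < t.word → q.word < t.word →
      ⁅commutatorAt g p, commutatorAt g q⁆ ∈ stdSpan g n (· < t.word) := by
    intro p q hp hq hpq hpt hqt
    rcases lt_trichotomy p.word q.word with h | h | h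
    · exact stdSpan_mono g n (fun w hw => lt_trans hw hqt)
        (ihv q.word (by simp only [Set.mem_ofPred_eq]; omega) hqt p q hp hq hpq h rfl)
    · rw [hp.word_injective hq h, commutatorElement_self]
      exact one_mem _
    · rw [← commutatorElement_inv]
      exact inv_mem (stdSpan_mono g n (fun w hw => lt_trans hw hpt)
        (ihv p.word (by simp only [Set.mem_ofPred_eq]; omega) hpt q p hq hp (by omega) h rfl))
  by_cases hst : (FreeMagma.mul s t).IsStd
  · have := commutatorAt_mem_stdSpan g hst (P := (· < t.word)) hst.word_append_lt
    rwa [word_mul, List.length_append, hn] at this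
  cases s with
  | of a => exact absurd ⟨ht, hlt⟩ hst
  | mul p q =>
    have hp := hs.left
    have hq := hs.right
    have hqt : q.word < t.word := by
      by_contra h
      exact hst ⟨hs, ht, hlt, h⟩
    have hpt : p.word < t.word := (not_lt.mp (List.not_append_lt_self p.word q.word)).trans_lt hlt
    rw [word_mul, List.length_append] at hn
    have hp1 := p.word_length_pos
    have hq1 := q.word_length_pos
    have ht1 := t.word_length_pos
    have mp := commutatorAt_mem_weightSeries g p
    have mq := commutatorAt_mem_weightSeries g q
    have mt := commutatorAt_mem_weightSeries g t
    -- Nonstandardness means q < t. Jacobi replaces [[p, q], t] by [[q, t], p] and [[t, p], q]; the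
    -- inner brackets have smaller weight and expand into standard commutators with words below t.
    -- Both words in each outer bracket are then below t, so the induction on the larger word
    -- applies. The bound `< t.word` in the conclusion is what makes this work.
    have jac := mk_commutator_jacobi mp mq mt hp1 hq1 ht1
    rw [hn] at jac
    have h1 : ⁅⁅commutatorAt g q, commutatorAt g t⁆, commutatorAt g p⁆ ∈
        stdSpan g n (· < t.word) := by
      refine commutator_mem_of_closure (stdCommutators_subset g _ _)
        (ihn _ (by omega) q t hq ht rfl hqt) mp ?_ ?_
      · rw [show q.word.length + t.word.length + p.word.length = n by omega]
        exact weightSeries_le_stdSpan g n _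
      · rintro _ ⟨r, hr, hrl, hrt, rfl⟩
        exact small r p hr hp (by omega) hrt hpt
    have h2 : ⁅⁅commutatorAt g t, commutatorAt g p⁆, commutatorAt g q⁆ ∈
        stdSpan g n (· < t.word) := by
      have hmem := inv_mem (ihn _ (by omega) p t hp ht rfl hpt)
      rw [commutatorElement_inv] at hmem
      refine commutator_mem_of_closure (stdCommutators_subset g _ _) hmem mq ?_ ?_
      · rw [show p.word.length + t.word.length + q.word.length = n by omega]
        exact weightSeries_le_stdSpan g n _
      · rintro _ ⟨r, hr, hrl, hrt, rfl⟩
        exact small r q hr hq (by omega) hrt hqt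
    have h3 := mem_of_mk_eq (weightSeries_le_stdSpan g n (· < t.word)) jac (one_mem _)
    exact (mul_mem_cancel_right h1).mp ((mul_mem_cancel_right h2).mp h3)

/-- The elements of weight `n` are generated by the standard commutators of weight `n` modulo the
elements of larger weight. -/
theorem stdSpan_eq_weightSeries [Finite α] (g : α → G) (hg : closure (Set.range g) = ⊤) {n : ℕ}
    (hn : 1 ≤ n) : stdSpan g n (fun _ => True) = weightSeries G n := by
  refine le_antisymm (stdSpan_le g n _) ?_
  induction n, hn using Nat.le_induction with
  | base =>
    rw [weightSeries_one, ← hg, closure_le]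
    rintro _ ⟨a, rfl⟩
    exact commutatorAt_mem_stdSpan g (t := .of a) trivial trivial
  | succ n hn ih =>
    rw [weightSeries_succ n hn, commutator_le]
    rintro x hx y -
    refine commutator_mem_of_closure (j := 1) (stdCommutators_subset g _ _) (ih hx) (mem_top y)
      (weightSeries_le_stdSpan g _ _) ?_
    rintro _ ⟨r, hr, hrl, -, rfl⟩
    -- The left slot is already a standard commutator; now the right slot is expanded into letters,
    -- after swapping the slots by inversion.
    have hy : y ∈ stdSpan g 1 (fun _ => True) := by
      have : (⊤ : Subgroup G) ≤ stdSpan g 1 (fun _ => True) := by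
        rw [← hg, closure_le]
        rintro _ ⟨a, rfl⟩
        exact commutatorAt_mem_stdSpan g (t := .of a) trivial trivial
      exact this (mem_top y)
    have key : ⁅y, commutatorAt g r⁆ ∈ stdSpan g (n + 1) (fun _ => True) := by
      refine commutator_mem_of_closure (i := 1) (stdCommutators_subset g _ _) hy
        (commutatorAt_mem_weightSeries g r) ?_ ?_
      · rw [hrl, add_comm 1 n]
        exact weightSeries_le_stdSpan g _ _
      · rintro _ ⟨q, hq, hql, -, rfl⟩
        rcases lt_trichotomy q.word r.word with h | h | h
        · exact stdSpan_mono g _ (fun _ _ => trivial)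
            (commutator_mem_stdSpan g (n + 1) q r hq hr (by omega) h)
        · rw [hq.word_injective hr h, commutatorElement_self]
          exact one_mem _
        · rw [← commutatorElement_inv]
          exact inv_mem (stdSpan_mono g _ (fun _ _ => trivial)
            (commutator_mem_stdSpan g (n + 1) r q hr hq (by omega) h))
    rw [← commutatorElement_inv]
    exact inv_mem key

end FreeMagma

/-! ### The Magnus representation by operators on power series. -/

namespace Magnus

open Subgroup

variable {α : Type*}

/-- Noncommutative formal power series over `ℤ`, as functions of words. -/
abbrev Series (α : Type*) : Type _ := List α → ℤ

/-- The operator `P` raises the order of a series by `m`, and acts on the lowest order term of a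
series as multiplication from the left by the homogeneous series `p` of degree `m`. -/
def HasSymbol (P : Module.End ℤ (Series α)) (m : ℕ) (p : Series α) : Prop :=
  ∀ (f : Series α) (k : ℕ), (∀ w : List α, w.length < k → f w = 0) →
    (∀ w : List α, w.length < m + k → P f w = 0) ∧
    ∀ z w : List α, z.length = m → w.length = k → P f (z ++ w) = p z * f w

/-- The product of homogeneous series, the first factor being of degree `m`. -/
def homogMul (m : ℕ) (p q : Series α) : Series α := fun z => p (z.take m) * q (z.drop m)

namespace HasSymbol

variable {P Q : Module.End ℤ (Series α)} {m n : ℕ} {p q : Series α}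

theorem congr (h : HasSymbol P m p) (hpq : ∀ z : List α, z.length = m → p z = q z) :
    HasSymbol P m q := fun f k hf =>
  ⟨(h f k hf).1, fun z w hz hw => by rw [(h f k hf).2 z w hz hw, hpq z hz]⟩

theorem one : HasSymbol (1 : Module.End ℤ (Series α)) 0 (fun _ => 1) := fun f k hf =>
  ⟨fun w hw => hf w (by omega), fun z w hz _ => by
    obtain rfl := List.length_eq_zero_iff.mp hz
    simp⟩

theorem zero : HasSymbol (0 : Module.End ℤ (Series α)) m (fun _ => 0) := fun f k hf =>
  ⟨fun w hw => rfl, fun z w hz _ => by simp⟩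

theorem add (hP : HasSymbol P m p) (hQ : HasSymbol Q m q) : HasSymbol (P + Q) m (p + q) :=
  fun f k hf =>
  ⟨fun w hw => by
    rw [LinearMap.add_apply, Pi.add_apply, (hP f k hf).1 w hw, (hQ f k hf).1 w hw, add_zero],
  fun z w hz hw => by
    rw [LinearMap.add_apply, Pi.add_apply, (hP f k hf).2 z w hz hw, (hQ f k hf).2 z w hz hw,
      Pi.add_apply, add_mul]⟩

theorem neg (hP : HasSymbol P m p) : HasSymbol (-P) m (-p) := fun f k hf =>
  ⟨fun w hw => by rw [LinearMap.neg_apply, Pi.neg_apply, (hP f k hf).1 w hw, neg_zero],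
  fun z w hz hw => by
    rw [LinearMap.neg_apply, Pi.neg_apply, (hP f k hf).2 z w hz hw, Pi.neg_apply, neg_mul]⟩

theorem sub (hP : HasSymbol P m p) (hQ : HasSymbol Q m q) : HasSymbol (P - Q) m (p - q) := by
  rw [sub_eq_add_neg, sub_eq_add_neg]
  exact hP.add hQ.neg

theorem mul (hP : HasSymbol P m p) (hQ : HasSymbol Q n q) :
    HasSymbol (P * Q) (m + n) (homogMul m p q) := fun f k hf => by
  have h := hP (Q f) (n + k) (hQ f k hf).1
  refine ⟨fun w hw => h.1 w (by omega), fun z w hz hw => ?_⟩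
  have h1 := h.2 (z.take m) (z.drop m ++ w) (by simp; omega) (by simp; omega)
  rw [← List.append_assoc, List.take_append_drop] at h1
  rw [Module.End.mul_apply, h1, (hQ f k hf).2 _ w (by simp; omega) hw, homogMul, mul_assoc]

theorem of_lt (hP : HasSymbol P n p) (h : m < n) : HasSymbol P m (fun _ => 0) := fun f k hf =>
  ⟨fun w hw => (hP f k hf).1 w (by omega), fun z w hz hw => by
    rw [(hP f k hf).1 _ (by simp; omega), zero_mul]⟩

theorem mul_of_one (hP : HasSymbol P m p) (hQ : HasSymbol Q 0 (fun _ => 1)) :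
    HasSymbol (P * Q) m p :=
  (hP.mul hQ).congr fun z hz => by
    rw [homogMul, List.take_of_length_le (i := m) hz.le, mul_one]

/-- The constant series `1`. -/
def constOne : Series α
  | [] => 1
  | _ :: _ => 0

/-- Evaluating at the series 1 recovers the symbol, so coefficients can be read off without a
product on series. -/
theorem apply_constOne (hP : HasSymbol P m p) {z : List α} (hz : z.length = m) :
    P constOne z = p z := by
  have := (hP constOne 0 (by simp)).2 z [] hz rfl
  simpa [constOne] using this

end HasSymbol

variable [DecidableEq α]

/-- Multiplication of a series from the left by a variable. -/
def varMul (a : α) : Module.End ℤ (Series α) where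
  toFun f
    | [] => 0
    | b :: w => if b = a then f w else 0
  map_add' f g := by
    funext w
    rcases w with _ | ⟨b, w⟩
    · simp
    · simp only [Pi.add_apply]
      split_ifs <;> simp
  map_smul' c f := by
    funext w
    rcases w with _ | ⟨b, w⟩
    · simp
    · simp

@[simp] theorem varMul_nil (a : α) (f : Series α) : varMul a f [] = 0 := rfl

@[simp] theorem varMul_cons (a b : α) (f : Series α) (w : List α) :
    varMul a f (b :: w) = if b = a then f w else 0 := rfl

/-- The product of a series with the inverse of `1 + a`, for a variable `a`. -/
def oneAddVarInvFun (a : α) (f : Series α) : Series α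
  | [] => f []
  | b :: w => f (b :: w) - if b = a then oneAddVarInvFun a f w else 0

/-- Multiplication of a series from the left by the inverse of `1 + a`, for a variable `a`. -/
def oneAddVarInv (a : α) : Module.End ℤ (Series α) where
  toFun := oneAddVarInvFun a
  map_add' f g := by
    funext w
    induction w with
    | nil => rfl
    | cons b w ih =>
      simp only [oneAddVarInvFun, Pi.add_apply] at *
      rw [ih]
      split_ifs <;> ring
  map_smul' c f := by
    funext w
    induction w with
    | nil => rfl
    | cons b w ih =>
      simp only [oneAddVarInvFun, Pi.smul_apply, smul_eq_mul, RingHom.id_apply] at *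
      rw [ih]
      split_ifs <;> ring

@[simp] theorem oneAddVarInv_nil (a : α) (f : Series α) : oneAddVarInv a f [] = f [] := rfl

@[simp] theorem oneAddVarInv_cons (a b : α) (f : Series α) (w : List α) :
    oneAddVarInv a f (b :: w) = f (b :: w) - if b = a then oneAddVarInv a f w else 0 := rfl

/-- Multiplication by `1 + a`, for a variable `a`, as a unit. -/
def oneAddVar (a : α) : (Module.End ℤ (Series α))ˣ where
  val := 1 + varMul a
  inv := oneAddVarInv a
  val_inv := by
    refine LinearMap.ext fun f => funext fun w => ?_
    rcases w with _ | ⟨b, w⟩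
    · simp
    · simp
  inv_val := by
    refine LinearMap.ext fun f => funext fun w => ?_
    induction w with
    | nil => simp
    | cons b w ih =>
      rw [Module.End.mul_apply, Module.End.one_apply] at *
      rw [oneAddVarInv_cons, ih, LinearMap.add_apply, Pi.add_apply, Module.End.one_apply,
        varMul_cons, add_sub_cancel_right]

theorem hasSymbol_varMul (a : α) : HasSymbol (varMul a) 1 (fun z => if z = [a] then 1 else 0) := by
  intro f k hf
  refine ⟨fun w hw => ?_, fun z w hz hw => ?_⟩
  · rcases w with _ | ⟨b, w⟩
    · rfl
    · rw [varMul_cons, hf w (by simp at hw; omega), ite_self]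
  · obtain ⟨b, rfl⟩ := List.length_eq_one_iff.mp hz
    by_cases h : b = a <;> simp [h]

theorem hasSymbol_oneAddVarInv (a : α) : HasSymbol (oneAddVarInv a) 0 (fun _ => 1) := by
  intro f k hf
  have h : ∀ w : List α, w.length < k → oneAddVarInv a f w = 0 := by
    intro w
    induction w with
    | nil => exact hf []
    | cons b w ih =>
      intro hw
      rw [oneAddVarInv_cons, hf _ hw, ih (by simp at hw; omega), ite_self, sub_zero]
  refine ⟨fun w hw => h w (by omega), fun z w hz hw => ?_⟩
  obtain rfl := List.length_eq_zero_iff.mp hz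
  rw [List.nil_append, one_mul]
  rcases w with _ | ⟨b, w⟩
  · rfl
  · rw [oneAddVarInv_cons, h w (by simp at hw; omega), ite_self, sub_zero]

/-- The Magnus representation of the free group. -/
def rep (α : Type*) [DecidableEq α] : FreeGroup α →* (Module.End ℤ (Series α))ˣ :=
  FreeGroup.lift oneAddVar

/-- The difference of the Magnus representation and the identity. -/
def dev (g : FreeGroup α) : Module.End ℤ (Series α) := (rep α g : Module.End ℤ (Series α)) - 1

theorem dev_one : dev (1 : FreeGroup α) = 0 := by simp [dev]

theorem dev_mul (g h : FreeGroup α) : dev (g * h) = dev g * dev h + (dev g + dev h) := by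
  simp only [dev, map_mul, Units.val_mul]
  noncomm_ring

theorem dev_inv (g : FreeGroup α) : dev g⁻¹ = -(dev g * (rep α g⁻¹ : Module.End ℤ (Series α))) := by
  simp only [dev, map_inv, sub_mul, Units.mul_inv, one_mul]
  abel

/-- This is [g, h] - 1 = (gh - hg) g⁻¹ h⁻¹, where gh - hg is unchanged when 1 is subtracted from
both g and h. -/
theorem dev_commutator (g h : FreeGroup α) : dev ⁅g, h⁆ =
    (dev g * dev h - dev h * dev g) * ((rep α g⁻¹ : Module.End ℤ (Series α)) *
      (rep α h⁻¹ : Module.End ℤ (Series α))) := by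
  have h1 : dev g * dev h - dev h * dev g = (rep α (g * h) : Module.End ℤ (Series α)) -
      (rep α (h * g) : Module.End ℤ (Series α)) := by
    simp only [dev, map_mul, Units.val_mul]
    noncomm_ring
  rw [h1, ← Units.val_mul, ← map_mul, sub_mul, ← Units.val_mul, ← Units.val_mul, ← map_mul,
    ← map_mul, dev, commutatorElement_def, show h * g * (g⁻¹ * h⁻¹) = 1 by group,
    show g * h * (g⁻¹ * h⁻¹) = g * h * g⁻¹ * h⁻¹ by group, map_one, Units.val_one]

/-- The product of the two deviations has order 2m > m, so only their sum is seen in degree m. -/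
theorem HasSymbol.dev_mul {g h : FreeGroup α} {m : ℕ} {p q : Series α} (hm : 1 ≤ m)
    (hg : HasSymbol (dev g) m p) (hh : HasSymbol (dev h) m q) :
    HasSymbol (dev (g * h)) m (p + q) := by
  rw [Magnus.dev_mul]
  exact (((hg.mul hh).of_lt (by omega)).add (hg.add hh)).congr fun z _ => by simp

theorem rep_of (a : α) : rep α (FreeGroup.of a) = oneAddVar a := FreeGroup.lift_apply_of ..

theorem hasSymbol_dev_of (a : α) :
    HasSymbol (dev (FreeGroup.of a)) 1 (fun z => if z = [a] then 1 else 0) := by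
  have : dev (FreeGroup.of a) = varMul a := by
    rw [dev, rep_of, oneAddVar]
    simp
  rw [this]
  exact hasSymbol_varMul a

theorem exists_hasSymbol_dev (g : FreeGroup α) : ∃ p, HasSymbol (dev g) 1 p := by
  induction g using FreeGroup.induction_on with
  | C1 => exact ⟨_, dev_one (α := α) ▸ HasSymbol.zero⟩
  | of a => exact ⟨_, hasSymbol_dev_of a⟩
  | inv_of a _ =>
    rw [dev_inv, map_inv, rep_of]
    exact ⟨_, ((hasSymbol_dev_of a).mul_of_one (hasSymbol_oneAddVarInv a)).neg⟩
  | mul g h hg hh =>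
    obtain ⟨p, hp⟩ := hg
    obtain ⟨q, hq⟩ := hh
    exact ⟨_, hp.dev_mul le_rfl hq⟩

theorem hasSymbol_rep (g : FreeGroup α) :
    HasSymbol (rep α g : Module.End ℤ (Series α)) 0 (fun _ => 1) := by
  obtain ⟨p, hp⟩ := exists_hasSymbol_dev g
  have : (rep α g : Module.End ℤ (Series α)) = dev g + 1 := by simp [dev]
  rw [this]
  exact ((hp.of_lt zero_lt_one).add HasSymbol.one).congr fun z _ => by simp

theorem HasSymbol.dev_inv {g : FreeGroup α} {m : ℕ} {p : Series α}
    (hg : HasSymbol (dev g) m p) : HasSymbol (dev g⁻¹) m (-p) := by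
  rw [Magnus.dev_inv]
  exact (hg.mul_of_one (hasSymbol_rep _)).neg

theorem HasSymbol.dev_commutator {g h : FreeGroup α} {m n : ℕ} {p q : Series α}
    (hg : HasSymbol (dev g) m p) (hh : HasSymbol (dev h) n q) :
    HasSymbol (dev ⁅g, h⁆) (m + n) (homogMul m p q - homogMul n q p) := by
  rw [Magnus.dev_commutator, ← mul_assoc]
  refine HasSymbol.mul_of_one (HasSymbol.mul_of_one ?_ (hasSymbol_rep _)) (hasSymbol_rep _)
  have := hh.mul hg
  rw [add_comm n m] at this
  exact (hg.mul hh).sub this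

/-- Commutators add orders, so γ_m acts as 1 plus terms of degree at least m. -/
theorem exists_hasSymbol_of_mem_weightSeries {m : ℕ} (hm : 1 ≤ m) {g : FreeGroup α}
    (hg : g ∈ weightSeries (FreeGroup α) m) : ∃ p, HasSymbol (dev g) m p := by
  induction m, hm using Nat.le_induction generalizing g with
  | base => exact exists_hasSymbol_dev g
  | succ m hm ih =>
    rw [weightSeries_succ m hm, Subgroup.commutator_def] at hg
    induction hg using closure_induction with
    | mem x hx =>
      obtain ⟨g, hg, h, -, rfl⟩ := hx
      obtain ⟨p, hp⟩ := ih hg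
      obtain ⟨q, hq⟩ := exists_hasSymbol_dev h
      exact ⟨_, hp.dev_commutator hq⟩
    | one => exact ⟨_, dev_one (α := α) ▸ HasSymbol.zero⟩
    | mul x y _ _ hx hy =>
      obtain ⟨p, hp⟩ := hx
      obtain ⟨q, hq⟩ := hy
      exact ⟨_, hp.dev_mul (by omega) hq⟩
    | inv x _ hx =>
      obtain ⟨p, hp⟩ := hx
      exact ⟨_, hp.dev_inv⟩

/-- The coefficients of the image of `g` under the Magnus embedding, minus `1`. -/
def coeff (g : FreeGroup α) : Series α := dev g HasSymbol.constOne

variable {n : ℕ} {g h : FreeGroup α} {z : List α}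

theorem coeff_mul (hn : 1 ≤ n) (hg : g ∈ weightSeries (FreeGroup α) n)
    (hh : h ∈ weightSeries (FreeGroup α) n) (hz : z.length = n) :
    coeff (g * h) z = coeff g z + coeff h z := by
  obtain ⟨p, hp⟩ := exists_hasSymbol_of_mem_weightSeries hn hg
  obtain ⟨q, hq⟩ := exists_hasSymbol_of_mem_weightSeries hn hh
  rw [coeff, coeff, coeff, hp.apply_constOne hz, hq.apply_constOne hz,
    (hp.dev_mul hn hq).apply_constOne hz, Pi.add_apply]

theorem coeff_inv (hn : 1 ≤ n) (hg : g ∈ weightSeries (FreeGroup α) n) (hz : z.length = n) :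
    coeff g⁻¹ z = -coeff g z := by
  obtain ⟨p, hp⟩ := exists_hasSymbol_of_mem_weightSeries hn hg
  rw [coeff, coeff, hp.apply_constOne hz, hp.dev_inv.apply_constOne hz, Pi.neg_apply]

theorem coeff_eq_zero (hg : g ∈ weightSeries (FreeGroup α) (n + 1)) (hz : z.length = n) :
    coeff g z = 0 := by
  obtain ⟨p, hp⟩ := exists_hasSymbol_of_mem_weightSeries (by omega) hg
  exact (hp.of_lt (Nat.lt_succ_self n)).apply_constOne hz

theorem coeff_one (z : List α) : coeff (1 : FreeGroup α) z = 0 := by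
  rw [coeff, dev_one]
  rfl

theorem coeff_pow (hn : 1 ≤ n) (hg : g ∈ weightSeries (FreeGroup α) n) (hz : z.length = n)
    (k : ℕ) : coeff (g ^ k) z = k * coeff g z := by
  induction k with
  | zero => simp [coeff_one]
  | succ k ih =>
    rw [pow_succ, coeff_mul hn (pow_mem hg k) hg hz, ih]
    push_cast
    ring

theorem coeff_zpow (hn : 1 ≤ n) (hg : g ∈ weightSeries (FreeGroup α) n) (hz : z.length = n)
    (k : ℤ) : coeff (g ^ k) z = k * coeff g z := by
  cases k with
  | ofNat k => simpa using coeff_pow hn hg hz k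
  | negSucc k =>
    rw [zpow_negSucc, coeff_inv hn (pow_mem hg _) hz, coeff_pow hn hg hz, Int.negSucc_eq]
    push_cast
    ring

end Magnus

/-! ### Triangularity, and torsion-freeness of γ_n/γ_{n+1}. -/

namespace Magnus

open Subgroup FreeMagma

variable {α : Type*} [LinearOrder α]

/-- The leading term of a standard commutator is its word. -/
theorem exists_hasSymbol_commutatorAt {t : FreeMagma α} (ht : t.IsStd) :
    ∃ p, HasSymbol (dev (commutatorAt FreeGroup.of t)) t.word.length p ∧ p t.word = 1 ∧
      ∀ z : List α, z.length = t.word.length → z < t.word → p z = 0 := by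
  induction t using FreeMagma.rec with
  | of a =>
    refine ⟨_, hasSymbol_dev_of a, by simp, fun z _ hz => ?_⟩
    rw [word_of] at hz
    simp [hz.ne]
  | mul s t ihs iht =>
    obtain ⟨p, hp, hp1, hp0⟩ := ihs ht.left
    obtain ⟨q, hq, hq1, hq0⟩ := iht ht.right
    have zero_pq : ∀ z : List α, z.length = s.word.length + t.word.length →
        z < s.word ++ t.word → homogMul s.word.length p q z = 0 := by
      intro z hz hlt
      rw [← List.take_append_drop s.word.length z] at hlt
      rcases List.append_lt_append_of_length_eq (by simp; omega) hlt with h | ⟨-, h⟩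
      · rw [homogMul, hp0 _ (by simp; omega) h, zero_mul]
      · rw [homogMul, hq0 _ (by simp; omega) h, mul_zero]
    have zero_qp : ∀ z : List α, z.length = s.word.length + t.word.length →
        z < t.word ++ s.word → homogMul t.word.length q p z = 0 := by
      intro z hz hlt
      rw [← List.take_append_drop t.word.length z] at hlt
      rcases List.append_lt_append_of_length_eq (by simp; omega) hlt with h | ⟨-, h⟩
      · rw [homogMul, hq0 _ (by simp; omega) h, zero_mul]
      · rw [homogMul, hp0 _ (by simp; omega) h, mul_zero]
    have hd := hp.dev_commutator hq
    rw [← List.length_append] at hd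
    refine ⟨_, hd, ?_, fun z hz hlt => ?_⟩
    -- Since st < ts, the product in the reverse order has no term at st, and the coefficient there
    -- is 1 · 1.
    · rw [Pi.sub_apply, word_mul, zero_qp _ (by simp) ht.word_append_lt_swap, homogMul,
        List.take_left, List.drop_left, hp1, hq1, mul_one, sub_zero]
    · rw [word_mul, List.length_append] at hz
      rw [Pi.sub_apply, zero_pq z hz hlt, zero_qp z hz (lt_trans hlt ht.word_append_lt_swap),
        sub_zero]

theorem coeff_commutatorAt_self {t : FreeMagma α} (ht : t.IsStd) :
    coeff (commutatorAt FreeGroup.of t) t.word = 1 := by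
  obtain ⟨p, hp, hp1, -⟩ := exists_hasSymbol_commutatorAt ht
  rw [coeff, hp.apply_constOne rfl, hp1]

theorem coeff_commutatorAt_of_lt {t : FreeMagma α} (ht : t.IsStd) {z : List α}
    (hz : z.length = t.word.length) (hlt : z < t.word) :
    coeff (commutatorAt FreeGroup.of t) z = 0 := by
  obtain ⟨p, hp, -, hp0⟩ := exists_hasSymbol_commutatorAt ht
  rw [coeff, hp.apply_constOne hz, hp0 z hz hlt]

theorem coeff_eq_zero_of_mem_stdSpan {n : ℕ} (hn : 1 ≤ n) {P : List α → Prop} {z : List α}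
    (hz : z.length = n) (hP : ∀ w, P w → z < w) {g : FreeGroup α}
    (hg : g ∈ stdSpan FreeGroup.of n P) : coeff g z = 0 := by
  have hle := (closure_le _).mpr (stdCommutators_subset (FreeGroup.of (α := α)) n P)
  obtain ⟨u, hu, v, hv, rfl⟩ := mem_sup_of_normal_right.mp hg
  rw [coeff_mul hn (hle hu) (weightSeries_antitone (Nat.le_succ n) hv) hz, coeff_eq_zero hv hz,
    add_zero]
  clear hg
  induction hu using closure_induction with
  | mem x hx =>
    obtain ⟨t, ht, rfl, hPt, rfl⟩ := hx
    exact coeff_commutatorAt_of_lt ht hz (hP _ hPt)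
  | one => exact coeff_one z
  | mul x y hx hy ihx ihy => rw [coeff_mul hn (hle hx) (hle hy) hz, ihx, ihy, add_zero]
  | inv x hx ihx => rw [coeff_inv hn (hle hx) hz, ihx, neg_zero]

/-- The subgroup lies between γ_{n+1} and γ_n, and conjugation is trivial on γ_n modulo γ_{n+1}. -/
theorem _root_.FreeMagma.stdSpan_normal {G : Type*} [Group G] (g : α → G) (n : ℕ)
    (P : List α → Prop) : (stdSpan g n P).Normal := by
  refine ⟨fun x hx y => ?_⟩
  have h : y * x * y⁻¹ = ⁅y, x⁆ * x := by simp [commutatorElement_def]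
  rw [h]
  refine mul_mem (weightSeries_le_stdSpan g n P ?_) hx
  have := commutator_mem_weightSeries (m := 1) (mem_top y) (stdSpan_le g n P hx)
  rwa [add_comm] at this

/-- Words are removed from S in increasing order. At the least word, the other standard commutators
have coefficient 0 and its own has 1, so the coefficient of g is the exponent of that commutator;
being zero, it allows the word to be dropped. -/
theorem mem_weightSeries_of_mem_stdSpan {n : ℕ} (hn : 1 ≤ n) (S : Finset (List α))
    {g : FreeGroup α} (hg : g ∈ stdSpan FreeGroup.of n (· ∈ S))
    (hc : ∀ z : List α, z.length = n → coeff g z = 0) :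
    g ∈ weightSeries (FreeGroup α) (n + 1) := by
  induction S using Finset.induction_on_min with
  | empty =>
    have : stdCommutators (FreeGroup.of (α := α)) n (· ∈ (∅ : Finset (List α))) = ∅ :=
      Set.eq_empty_of_forall_notMem fun x ⟨r, _, _, h, _⟩ => by simp at h
    rwa [stdSpan, this, Subgroup.closure_empty, bot_sup_eq] at hg
  | insert a s ha ih =>
    refine ih ?_
    by_cases hr : ∃ r : FreeMagma α, r.IsStd ∧ r.word.length = n ∧ r.word = a
    · obtain ⟨r, hr, hrn, rfl⟩ := hr
      have := stdSpan_normal (FreeGroup.of (α := α)) n (· ∈ s)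
      have hle : stdSpan (FreeGroup.of (α := α)) n (· ∈ insert r.word s) ≤
          zpowers (commutatorAt FreeGroup.of r) ⊔ stdSpan FreeGroup.of n (· ∈ s) := by
        refine sup_le ((closure_le _).mpr ?_)
          ((weightSeries_le_stdSpan _ n _).trans le_sup_right)
        rintro _ ⟨t, ht, htn, hts, rfl⟩
        rcases Finset.mem_insert.mp hts with h | h
        · rw [ht.word_injective hr h]
          exact mem_sup_left (mem_zpowers _)
        · have := commutatorAt_mem_stdSpan (FreeGroup.of (α := α)) ht (P := (· ∈ s)) h
          rw [htn] at this
          exact mem_sup_right this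
      obtain ⟨_, ⟨k, rfl⟩, h, hh, rfl⟩ := mem_sup_of_normal_right.mp (hle hg)
      have hr' : commutatorAt FreeGroup.of r ∈ weightSeries (FreeGroup α) n :=
        hrn ▸ commutatorAt_mem_weightSeries _ r
      have h1 := hc r.word hrn
      simp only at h1
      rw [coeff_mul hn (zpow_mem hr' k) (stdSpan_le _ n _ hh) hrn, coeff_zpow hn hr' hrn,
        coeff_commutatorAt_self hr, coeff_eq_zero_of_mem_stdSpan hn hrn ha hh, add_zero,
        mul_one] at h1
      have hk : k = 0 := by exact_mod_cast h1
      simpa [hk] using hh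
    · have hle : stdSpan (FreeGroup.of (α := α)) n (· ∈ insert a s) ≤
          stdSpan FreeGroup.of n (· ∈ s) := by
        refine sup_le_sup_right (Subgroup.closure_mono ?_) _
        rintro _ ⟨t, ht, htn, hts, rfl⟩
        refine ⟨t, ht, htn, (Finset.mem_insert.mp hts).resolve_left fun h => hr ⟨t, ht, htn, h⟩, rfl⟩
      exact hle hg

/-- An element of `γ_n` of a free group is in `γ_{n+1}` if the terms of degree `n` of its image under
the Magnus embedding vanish. -/
theorem mem_weightSeries_succ_of_coeff_eq_zero [Finite α] {n : ℕ} (hn : 1 ≤ n) {g : FreeGroup α}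
    (hg : g ∈ weightSeries (FreeGroup α) n)
    (hc : ∀ z : List α, z.length = n → coeff g z = 0) :
    g ∈ weightSeries (FreeGroup α) (n + 1) := by
  rw [← stdSpan_eq_weightSeries FreeGroup.of (FreeGroup.closure_range_of α) hn] at hg
  refine mem_weightSeries_of_mem_stdSpan hn (List.finite_length_le α n).toFinset ?_ hc
  have hle : stdSpan (FreeGroup.of (α := α)) n (fun _ => True) ≤
      stdSpan FreeGroup.of n (· ∈ (List.finite_length_le α n).toFinset) := by
    refine sup_le_sup_right (Subgroup.closure_mono ?_) _
    rintro _ ⟨t, ht, htn, -, rfl⟩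
    exact ⟨t, ht, htn, by simp [htn], rfl⟩
  exact hle hg

/-- The quotients of the lower central series of a free group are torsion-free. -/
theorem mem_weightSeries_succ_of_pow_mem [Finite α] {n : ℕ} (hn : 1 ≤ n) {g : FreeGroup α}
    (hg : g ∈ weightSeries (FreeGroup α) n) {k : ℕ} (hk : k ≠ 0)
    (hgk : g ^ k ∈ weightSeries (FreeGroup α) (n + 1)) :
    g ∈ weightSeries (FreeGroup α) (n + 1) := by
  refine mem_weightSeries_succ_of_coeff_eq_zero hn hg fun z hz => ?_
  have h := coeff_eq_zero hgk hz
  rw [coeff_pow hn hg hz] at h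
  exact (mul_eq_zero.mp h).resolve_left (by exact_mod_cast hk)

end Magnus

/-! ### Vanishing of homogeneous cocycles. -/

/-- A normalized 2-cocycle that is homogeneous of degree `n ≥ 3` vanishes. -/
theorem cocycle_eq_zero_of_homogeneous {G A : Type*} [Group G] [AddCommGroup A]
    {C : G → G → A} {n : ℕ} (hn : 3 ≤ n) (K : AddSubgroup A) (hK : ∀ a b, C a b ∈ K)
    (tf : ∀ z ∈ K, ∀ k : ℕ, k ≠ 0 → k • z = 0 → z = 0)
    (hleft : ∀ a b e, C (a * b) e = C (b * a) e)
    (hright : ∀ a b e, C e (a * b) = C e (b * a))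
    (hcoc : ∀ a b e, C a b + C (a * b) e = C b e + C a (b * e))
    (hdiag : ∀ a, C a a = 0) (hsq : ∀ a b, C (a * a) (b * b) = 2 ^ n • C a b) (a b : G) :
    C a b = 0 := by
  have cancel : ∀ (z : A) (m : ℕ), z ∈ K → m < 2 ^ n → 2 ^ n • z = m • z → z = 0 := by
    intro z m hz hm h
    obtain ⟨k, hk⟩ := Nat.exists_eq_add_of_lt hm
    refine tf z hz (k + 1) (Nat.succ_ne_zero k) ?_
    rw [hk, add_assoc, add_nsmul] at h
    exact add_eq_left.mp h
  have h8 : 2 ^ 3 ≤ 2 ^ n := Nat.pow_le_pow_right (by norm_num) hn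
  -- The antisymmetrization of C is additive in its first argument, by the cocycle identity at (a,
  -- b, e), (e, a, b) and (a, e, b).
  have hB : ∀ a b e, C (a * b) e - C e (a * b) = C a e - C e a + (C b e - C e b) := by
    intro a b e
    have h1 := hcoc a b e
    have h2 := hcoc e a b
    have h3 := hcoc a e b
    rw [hleft e a] at h2
    rw [hright e b] at h3
    linear_combination (norm := abel) h1 + h2 - h3
  have hB' : ∀ a b e, C e (a * b) - C (a * b) e = C e a - C a e + (C e b - C b e) := by
    intro a b e
    linear_combination (norm := abel) -hB a b e
  have symm : ∀ a b, C a b = C b a := by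
    intro a b
    -- Biadditivity gives the factor 4, homogeneity gives 2^n; they differ because n ≥ 3. In degree
    -- 2 the commutator itself would be a counterexample.
    refine sub_eq_zero.mp (cancel _ 4 (sub_mem (hK a b) (hK b a)) (by omega) ?_)
    rw [nsmul_sub, ← hsq, ← hsq, hB, hB']
    abel
  refine cancel _ 2 (hK a b) (by omega) ?_
  -- Together with symmetry and the zero diagonal, these three instances give C(a², b²) = 2 C(a, b).
  have h1 := hcoc a b (a * b)
  have h2 := hcoc b b a
  have h3 := hcoc a a (b * b)
  have e1 : C a (b * (a * b)) = C a (a * (b * b)) := by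
    rw [hright, mul_assoc]
  rw [hdiag, e1, hright a b b] at h1
  rw [hdiag, symm (b * b) a, symm b a] at h2
  rw [hdiag] at h3
  rw [← hsq]
  linear_combination (norm := abel) h3 - h1 + h2

/-! ### Free nilpotent groups. -/

namespace NF

open Subgroup

variable {i d : ℕ}

theorem closure_range_gen (i d : ℕ) : closure (Set.range (gen i d)) = ⊤ := by
  have h : Set.range (gen i d) = QuotientGroup.mk' _ '' Set.range (FreeGroup.of (α := Fin i)) := by
    rw [← Set.range_comp]
    rfl
  rw [h, ← MonoidHom.map_closure, FreeGroup.closure_range_of,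
    map_top_of_surjective _ (QuotientGroup.mk'_surjective _)]

theorem hom_ext {G : Type*} [Group G] {f g : NF i d →* G} (h : ∀ k, f (gen i d k) = g (gen i d k)) :
    f = g :=
  MonoidHom.eq_of_eqOn_dense (closure_range_gen i d) (by rintro _ ⟨k, rfl⟩; exact h k)

theorem weightSeries_succ_eq_bot (i d : ℕ) : weightSeries (NF i d) (d + 1) = ⊥ :=
  nilpotentClassLE i d

/-- The last nontrivial term of the lower central series of a free nilpotent group is
torsion-free. -/
theorem eq_one_of_pow_eq_one (hd : 1 ≤ d) {c : NF i d} (hc : c ∈ weightSeries (NF i d) d) {k : ℕ}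
    (hk : k ≠ 0) (h : c ^ k = 1) : c = 1 := by
  rw [← map_weightSeries_of_surjective (QuotientGroup.mk' _) (QuotientGroup.mk'_surjective _)] at hc
  obtain ⟨g, hg, rfl⟩ := hc
  rw [← map_pow] at h
  exact (QuotientGroup.eq_one_iff g).mpr (Magnus.mem_weightSeries_succ_of_pow_mem hd hg hk
    ((QuotientGroup.eq_one_iff (g ^ k)).mp h))

theorem eq_of_mk_eq_mk {a b : NF i d} (h : (a : NF i d ⧸ weightSeries (NF i d) (d + 1)) = b) :
    a = b := by
  rw [QuotientGroup.eq, weightSeries_succ_eq_bot, mem_bot] at h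
  exact (inv_mul_eq_one.mp h)

theorem commute_of_mem_weightSeries {c : NF i d} (hc : c ∈ weightSeries (NF i d) d) (g : NF i d) :
    Commute g c :=
  eq_of_mk_eq_mk (by simpa using (commute_mk_of_mem_weightSeries hc g).eq)

theorem mk_map_eq_pow_of_gen {G : Type*} [Group G] {f f' : NF i d →* G} {k : ℕ}
    (h : ∀ j, (f' (gen i d j) : G ⧸ weightSeries G 2) = (f (gen i d j) ^ k : G)) (g : NF i d) :
    (f' g : G ⧸ weightSeries G 2) = (f g ^ k : G) := by
  have hg : g ∈ closure (Set.range (gen i d)) := closure_range_gen i d ▸ mem_top g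
  induction hg using closure_induction with
  | mem x hx =>
    obtain ⟨j, rfl⟩ := hx
    exact h j
  | one => simp
  | mul x y _ _ hx hy =>
    have := commute_mk_of_mem_weightSeries (n := 1) (mem_top (f y)) (f x)
    rw [map_mul, map_mul, QuotientGroup.mk_mul, hx, hy, QuotientGroup.mk_pow, QuotientGroup.mk_pow,
      QuotientGroup.mk_pow, QuotientGroup.mk_mul, this.mul_pow]
  | inv x _ hx => rw [map_inv, map_inv, QuotientGroup.mk_inv, hx, inv_pow, QuotientGroup.mk_inv]

end NF

/-! ### Words in the last term of the series as cocycles. -/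

section StarOp

open Subgroup NF

variable {d : ℕ}

/-- The endomorphism of `NF 2 d` which sends the free generators to `a` and `b`. -/
def evalHom (a b : NF 2 d) : NF 2 d →* NF 2 d := NF.lift (NF.nilpotentClassLE 2 d) ![a, b]

@[simp] theorem evalHom_gen_zero (a b : NF 2 d) : evalHom a b (gen 2 d 0) = a :=
  NF.lift_gen _ _ _

@[simp] theorem evalHom_gen_one (a b : NF 2 d) : evalHom a b (gen 2 d 1) = b :=
  NF.lift_gen _ _ _

theorem starOp_eq (w a b : NF 2 d) : starOp w a b = evalHom a b w := rfl

/-- A word in γ_d is homogeneous of degree d modulo γ_{d+1}, which is trivial here. The case k = 1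
says that its value depends only on the arguments modulo γ_2. -/
theorem evalHom_pow_of_mem {a b a' b' : NF 2 d} {k : ℕ}
    (ha : (a' : NF 2 d ⧸ weightSeries (NF 2 d) 2) = (a ^ k : NF 2 d))
    (hb : (b' : NF 2 d ⧸ weightSeries (NF 2 d) 2) = (b ^ k : NF 2 d)) (hd : 1 ≤ d) {c : NF 2 d}
    (hc : c ∈ weightSeries (NF 2 d) d) : evalHom a' b' c = evalHom a b c ^ k ^ d := by
  refine eq_of_mk_eq_mk (mk_map_eq_pow _ _ k (mk_map_eq_pow_of_gen fun j => ?_) hd hc)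
  fin_cases j
  · simpa using ha
  · simpa using hb

theorem evalHom_congr {a b a' b' : NF 2 d}
    (ha : (a' : NF 2 d ⧸ weightSeries (NF 2 d) 2) = a)
    (hb : (b' : NF 2 d ⧸ weightSeries (NF 2 d) 2) = b) (hd : 1 ≤ d) {c : NF 2 d}
    (hc : c ∈ weightSeries (NF 2 d) d) : evalHom a' b' c = evalHom a b c := by
  have := evalHom_pow_of_mem (k := 1) (by simpa using ha) (by simpa using hb) hd hc
  simpa using this

/-- The image of this endomorphism is cyclic, so commutators die. -/
theorem evalHom_self_eq_one (a : NF 2 d) {c : NF 2 d} (hc : c ∈ weightSeries (NF 2 d) 2) :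
    evalHom a a c = 1 := by
  have hrange : ∀ g, evalHom a a g ∈ zpowers a := by
    intro g
    have hle : closure (Set.range (gen 2 d)) ≤ (zpowers a).comap (evalHom a a) := by
      rw [closure_le]
      rintro _ ⟨j, rfl⟩
      fin_cases j <;> simp
    exact hle (closure_range_gen 2 d ▸ mem_top g)
  have hle : weightSeries (NF 2 d) 2 ≤ (evalHom a a).ker := by
    rw [weightSeries_succ 1 le_rfl, commutator_le]
    intro p _ q _
    rw [MonoidHom.mem_ker, map_commutatorElement, commutatorElement_eq_one_iff_mul_comm]
    obtain ⟨m, hm⟩ := hrange p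
    obtain ⟨n, hn⟩ := hrange q
    rw [← hm, ← hn]
    exact zpow_mul_comm a m n
  exact hle hc

open scoped IsMulCommutative in
/-- If the operation of `x y c` is associative, for `c` in the last term of the lower central
series, then `c = 1`. -/
theorem eq_one_of_assoc (hd : 3 ≤ d) {c : NF 2 d} (hc : c ∈ weightSeries (NF 2 d) d)
    (hassoc : ∀ a b e, starOp (gen 2 d 0 * gen 2 d 1 * c) (starOp (gen 2 d 0 * gen 2 d 1 * c) a b) e
      = starOp (gen 2 d 0 * gen 2 d 1 * c) a (starOp (gen 2 d 0 * gen 2 d 1 * c) b e)) :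
    c = 1 := by
  have hw : ∀ a b, starOp (gen 2 d 0 * gen 2 d 1 * c) a b = a * b * evalHom a b c := fun a b => by
    rw [starOp_eq, map_mul, map_mul, evalHom_gen_zero, evalHom_gen_one]
  have hmem : ∀ a b, evalHom a b c ∈ weightSeries (NF 2 d) d := fun a b =>
    map_mem_weightSeries _ hc
  have hcomm : ∀ a b g, Commute g (evalHom a b c) := fun a b g =>
    commute_of_mem_weightSeries (hmem a b) g
  have h2 : weightSeries (NF 2 d) d ≤ weightSeries (NF 2 d) 2 := weightSeries_antitone (by omega)
  have hswap : ∀ a b : NF 2 d, ((a * b : NF 2 d) : NF 2 d ⧸ weightSeries (NF 2 d) 2) = (b * a : NF 2 d) :=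
    fun a b => (commute_mk_of_mem_weightSeries (n := 1) (mem_top b) a).eq
  have habs : ∀ g a b, ((g * evalHom a b c : NF 2 d) : NF 2 d ⧸ weightSeries (NF 2 d) 2) = g :=
    fun g a b => by
      rw [QuotientGroup.mk_mul, (QuotientGroup.eq_one_iff _).mpr (h2 (hmem a b)), mul_one]
  -- The center serves as the commutative target; torsion-freeness is used only on γ_d, where the
  -- values lie.
  let C : NF 2 d → NF 2 d → Additive (center (NF 2 d)) := fun a b =>
    Additive.ofMul ⟨evalHom a b c, mem_center_iff.mpr fun g => hcomm a b g⟩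
  have hC : ∀ a b a' b', evalHom a b c = evalHom a' b' c → C a b = C a' b' := fun a b a' b' h =>
    congrArg Additive.ofMul (Subtype.ext h)
  have hzero : ∀ a b, C a b = 0 := by
    refine cocycle_eq_zero_of_homogeneous hd
      (((weightSeries (NF 2 d) d).subgroupOf (center (NF 2 d))).toAddSubgroup) (fun a b => hmem a b)
      ?_ (fun a b e => hC _ _ _ _ (evalHom_congr (hswap a b) rfl (by omega) hc))
      (fun a b e => hC _ _ _ _ (evalHom_congr rfl (hswap a b) (by omega) hc)) ?_ ?_ ?_
    · intro z hz k hk hkz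
      exact congrArg Additive.ofMul (Subtype.ext (eq_one_of_pow_eq_one (by omega) hz hk
        (congrArg Subtype.val (congrArg Additive.toMul hkz))))
    · intro a b e
      refine congrArg Additive.ofMul (Subtype.ext ?_)
      -- The correction factors do not affect arguments modulo γ_2 and are central; cancelling a b e
      -- from associativity leaves the cocycle identity.
      have h := hassoc a b e
      rw [hw, hw, hw, hw, evalHom_congr (habs _ a b) rfl (by omega) hc,
        evalHom_congr rfl (habs _ b e) (by omega) hc, mul_assoc (a * b),
        ← (hcomm a b e).eq, mul_assoc, mul_assoc, mul_assoc a, mul_assoc, mul_assoc,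
        mul_assoc] at h
      exact mul_left_cancel (mul_left_cancel (mul_left_cancel h))
    · exact fun a => congrArg Additive.ofMul (Subtype.ext (evalHom_self_eq_one a (h2 hc)))
    · intro a b
      refine congrArg Additive.ofMul (Subtype.ext ?_)
      exact evalHom_pow_of_mem (by rw [sq]) (by rw [sq]) (by omega) hc
  have h := congrArg Subtype.val (congrArg Additive.toMul (hzero (gen 2 d 0) (gen 2 d 1)))
  have hid : evalHom (gen 2 d 0) (gen 2 d 1) = MonoidHom.id (NF 2 d) :=
    hom_ext fun k => by fin_cases k <;> simp
  change evalHom (gen 2 d 0) (gen 2 d 1) c = 1 at h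
  rwa [hid] at h

end StarOp

/-! ### The Heisenberg group as a test group of class two. -/

theorem NilpotentClassLE.mono {C : Type*} [Group C] {m n : ℕ} (h : NilpotentClassLE m C)
    (hmn : m ≤ n) : NilpotentClassLE n C :=
  le_bot_iff.mp ((Subgroup.lowerCentralSeries_antitone _ hmn).trans_eq h)

theorem nilpotentClassLE_one_of_commGroup (C : Type*) [CommGroup C] : NilpotentClassLE 1 C := by
  refine le_bot_iff.mp ((Subgroup.commutator_le (H₃ := ⊥)).mpr fun a _ b _ => ?_)
  exact Subgroup.mem_bot.mpr (commutatorElement_eq_one_iff_mul_comm.mpr (mul_comm a b))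

/-- The integral Heisenberg group. -/
@[ext] structure Heisenberg where
  /-- The entry at position `(1, 2)`. -/
  a : ℤ
  /-- The entry at position `(2, 3)`. -/
  b : ℤ
  /-- The entry at position `(1, 3)`. -/
  c : ℤ

namespace Heisenberg

instance : Mul Heisenberg := ⟨fun p q => ⟨p.a + q.a, p.b + q.b, p.c + q.c + p.a * q.b⟩⟩

instance : One Heisenberg := ⟨⟨0, 0, 0⟩⟩

instance : Inv Heisenberg := ⟨fun p => ⟨-p.a, -p.b, -p.c + p.a * p.b⟩⟩

@[simp] theorem mul_a (p q : Heisenberg) : (p * q).a = p.a + q.a := rfl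
@[simp] theorem mul_b (p q : Heisenberg) : (p * q).b = p.b + q.b := rfl
@[simp] theorem mul_c (p q : Heisenberg) : (p * q).c = p.c + q.c + p.a * q.b := rfl
@[simp] theorem one_a : (1 : Heisenberg).a = 0 := rfl
@[simp] theorem one_b : (1 : Heisenberg).b = 0 := rfl
@[simp] theorem one_c : (1 : Heisenberg).c = 0 := rfl
@[simp] theorem inv_a (p : Heisenberg) : p⁻¹.a = -p.a := rfl
@[simp] theorem inv_b (p : Heisenberg) : p⁻¹.b = -p.b := rfl
@[simp] theorem inv_c (p : Heisenberg) : p⁻¹.c = -p.c + p.a * p.b := rfl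

instance : Group Heisenberg :=
  Group.ofLeftAxioms
    (fun p q r => by ext <;> simp <;> ring)
    (fun p => by ext <;> simp)
    (fun p => by ext <;> simp)

theorem commutator_eq (p q : Heisenberg) : ⁅p, q⁆ = ⟨0, 0, p.a * q.b - q.a * p.b⟩ := by
  rw [commutatorElement_def]
  ext <;> simp
  ring

theorem central_zpow (m k : ℤ) : (⟨0, 0, m⟩ : Heisenberg) ^ k = ⟨0, 0, k * m⟩ := by
  let f : Multiplicative ℤ →* Heisenberg :=
    { toFun := fun z => ⟨0, 0, z.toAdd⟩
      map_one' := rfl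
      map_mul' := fun x y => by ext <;> simp }
  have := map_zpow f (Multiplicative.ofAdd m) k
  rw [← ofAdd_zsmul, smul_eq_mul] at this
  exact this.symm

theorem nilpotentClassLE_two : NilpotentClassLE 2 Heisenberg := by
  have h1 : ∀ p ∈ (⊤ : Subgroup Heisenberg).lowerCentralSeries 1, p ∈ Subgroup.center Heisenberg := by
    change ⁅(⊤ : Subgroup Heisenberg), (⊤ : Subgroup Heisenberg)⁆ ≤ Subgroup.center Heisenberg
    rw [Subgroup.commutator_le]
    intro p _ q _
    rw [Subgroup.mem_center_iff, commutator_eq]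
    intro g
    ext <;> simp
    ring
  refine le_bot_iff.mp ((Subgroup.commutator_le (H₃ := ⊥)).mpr fun p hp q _ => ?_)
  exact Subgroup.mem_bot.mpr (commutatorElement_eq_one_iff_mul_comm.mpr
    (Subgroup.mem_center_iff.mp (h1 p hp) q).symm)

end Heisenberg

/-! ### Words that fulfill the condition. -/

section StarOp

open Subgroup NF

variable {d : ℕ}

theorem map_starOp {G : Type*} [Group G] (hG : NilpotentClassLE d G) (f : NF 2 d →* G)
    (w a b : NF 2 d) : f (starOp w a b) = NF.lift hG ![f a, f b] w := by
  rw [starOp_eq]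
  refine DFunLike.congr_fun (f := f.comp (evalHom a b)) (NF.hom_ext fun k => ?_) w
  fin_cases k <;> simp [NF.lift_gen]

/-- The word w(y, x) induces the opposite operation. -/
theorem starOp_starOp_swap (w a b : NF 2 d) :
    starOp (starOp w (gen 2 d 1) (gen 2 d 0)) a b = starOp w b a := by
  refine DFunLike.congr_fun (f := (evalHom a b).comp (evalHom (gen 2 d 1) (gen 2 d 0)))
    (g := evalHom b a) (NF.hom_ext fun k => ?_) w
  fin_cases k <;> simp

theorem starOp_gen (w : NF 2 d) : starOp w (gen 2 d 0) (gen 2 d 1) = w := by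
  refine DFunLike.congr_fun (f := evalHom (gen 2 d 0) (gen 2 d 1)) (g := MonoidHom.id _)
    (NF.hom_ext fun k => ?_) w
  fin_cases k <;> simp

namespace NF

variable {n : ℕ}

/-- The projection of a free nilpotent group to a free nilpotent group of smaller class. -/
def proj (hn : n ≤ d) : NF 2 d →* NF 2 n :=
  NF.lift ((NF.nilpotentClassLE 2 n).mono hn) (gen 2 n)

theorem proj_gen (hn : n ≤ d) (k : Fin 2) : proj hn (gen 2 d k) = gen 2 n k := NF.lift_gen _ _ _

theorem proj_mk (hn : n ≤ d) (g : FreeGroup (Fin 2)) :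
    proj hn (QuotientGroup.mk g : NF 2 d) = QuotientGroup.mk g := by
  refine DFunLike.congr_fun (f := (proj hn).comp (QuotientGroup.mk' _))
    (g := QuotientGroup.mk' _) (FreeGroup.ext_hom _ _ fun k => ?_) g
  exact proj_gen hn k

theorem proj_surjective (hn : n ≤ d) : Function.Surjective (proj hn) := by
  intro x
  obtain ⟨g, rfl⟩ := QuotientGroup.mk_surjective x
  exact ⟨_, proj_mk hn g⟩

theorem mem_weightSeries_of_proj_eq_one (hn : n ≤ d) {s : NF 2 d} (hs : proj hn s = 1) :
    s ∈ weightSeries (NF 2 d) (n + 1) := by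
  obtain ⟨g, rfl⟩ := QuotientGroup.mk_surjective s
  rw [proj_mk] at hs
  have hg : g ∈ weightSeries (FreeGroup (Fin 2)) (n + 1) := (QuotientGroup.eq_one_iff g).mp hs
  exact map_mem_weightSeries (QuotientGroup.mk' _) hg

theorem proj_starOp (hn : n ≤ d) (w a b : NF 2 d) :
    proj hn (starOp w a b) = starOp (proj hn w) (proj hn a) (proj hn b) := by
  rw [map_starOp ((NF.nilpotentClassLE 2 n).mono hn), starOp_eq]
  refine DFunLike.congr_fun (g := (evalHom (proj hn a) (proj hn b)).comp (proj hn))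
    (NF.hom_ext fun k => ?_) w
  fin_cases k <;> simp [NF.lift_gen, proj_gen]

end NF

/-- A word which agrees with `x y` modulo `γ_3` and induces an associative operation is `x y`. -/
theorem eq_gen_mul_gen_of_assoc {w : NF 2 d}
    (hw : (w : NF 2 d ⧸ weightSeries (NF 2 d) 3) = (gen 2 d 0 * gen 2 d 1 : NF 2 d))
    (hassoc : ∀ a b e, starOp w (starOp w a b) e = starOp w a (starOp w b e)) :
    w = gen 2 d 0 * gen 2 d 1 := by
  obtain ⟨s, rfl⟩ : ∃ s, w = gen 2 d 0 * gen 2 d 1 * s :=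
    ⟨(gen 2 d 0 * gen 2 d 1)⁻¹ * w, by group⟩
  have hs3 : s ∈ weightSeries (NF 2 d) 3 := by
    have := QuotientGroup.eq.mp hw.symm
    rwa [inv_mul_cancel_left] at this
  -- Once s is in γ_m, its image in class m lies in the last term and is killed by
  -- `eq_one_of_assoc`, so s is in γ_{m+1}.
  have hs : ∀ m, 3 ≤ m → m ≤ d + 1 → s ∈ weightSeries (NF 2 d) m := by
    intro m hm
    induction m, hm using Nat.le_induction with
    | base => exact fun _ => hs3
    | succ m hm ih =>
      intro hmd
      have hmd' : m ≤ d := by omega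
      refine mem_weightSeries_of_proj_eq_one hmd' (eq_one_of_assoc hm
        (map_mem_weightSeries _ (ih (by omega))) fun a b e => ?_)
      obtain ⟨a, rfl⟩ := proj_surjective hmd' a
      obtain ⟨b, rfl⟩ := proj_surjective hmd' b
      obtain ⟨e, rfl⟩ := proj_surjective hmd' e
      have := congrArg (proj hmd') (hassoc a b e)
      simpa only [proj_starOp, map_mul, proj_gen] using this
  have h1 : s = 1 := by
    rcases le_or_gt 2 d with h | h
    · have := hs (d + 1) (by omega) le_rfl
      rwa [weightSeries_succ_eq_bot, mem_bot] at this
    · have := weightSeries_antitone (show d + 1 ≤ 3 by omega) hs3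
      rwa [weightSeries_succ_eq_bot, mem_bot] at this
  rw [h1, mul_one]

theorem exists_zpow_mul_zpow (w : NF 2 d) : ∃ α β : ℤ,
    (w : NF 2 d ⧸ weightSeries (NF 2 d) 2) = (gen 2 d 0 ^ α * gen 2 d 1 ^ β : NF 2 d) := by
  have comm : ∀ x y : NF 2 d ⧸ weightSeries (NF 2 d) 2, Commute x y := by
    intro x y
    obtain ⟨x, rfl⟩ := QuotientGroup.mk_surjective x
    obtain ⟨y, rfl⟩ := QuotientGroup.mk_surjective y
    exact commute_mk_of_mem_weightSeries (n := 1) (mem_top y) x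
  have hw : w ∈ closure (Set.range (gen 2 d)) := closure_range_gen 2 d ▸ mem_top w
  induction hw using closure_induction with
  | mem x hx =>
    obtain ⟨j, rfl⟩ := hx
    fin_cases j
    · exact ⟨1, 0, by simp⟩
    · exact ⟨0, 1, by simp⟩
  | one => exact ⟨0, 0, by simp⟩
  | mul x y _ _ hx hy =>
    obtain ⟨α, β, h⟩ := hx
    obtain ⟨α', β', h'⟩ := hy
    refine ⟨α + α', β + β', ?_⟩
    rw [QuotientGroup.mk_mul, h, h']
    simp only [QuotientGroup.mk_mul, zpow_add]
    exact (comm _ _).mul_mul_mul_comm _ _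
  | inv x _ hx =>
    obtain ⟨α, β, h⟩ := hx
    refine ⟨-α, -β, ?_⟩
    rw [QuotientGroup.mk_inv, h]
    simp only [QuotientGroup.mk_mul, zpow_neg, QuotientGroup.mk_inv, mul_inv_rev]
    exact (comm _ _).eq

/-- A word whose operation has a neutral element agrees with `x y` modulo commutators. -/
theorem mk_eq_of_neutral (hd : 1 ≤ d) {w e : NF 2 d} (he : ∀ a, starOp w e a = a ∧ starOp w a e = a) :
    (w : NF 2 d ⧸ weightSeries (NF 2 d) 2) = (gen 2 d 0 * gen 2 d 1 : NF 2 d) := by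
  obtain ⟨α, β, h⟩ := exists_zpow_mul_zpow w
  have hZ : NilpotentClassLE d (Multiplicative ℤ) :=
    (nilpotentClassLE_one_of_commGroup (Multiplicative ℤ)).mono hd
  -- Any homomorphism to ℤ with a generator going to 1 will do: there the operation is αm + βn.
  -- Neutrality at 0 removes the contribution of e, and at 1 it gives α = β = 1.
  let f : NF 2 d →* Multiplicative ℤ := NF.lift hZ fun _ => Multiplicative.ofAdd 1
  have hfx : f (gen 2 d 0) = Multiplicative.ofAdd 1 := NF.lift_gen _ _ _
  have hf : ∀ a b, f (starOp w a b) = f a ^ α * f b ^ β := by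
    intro a b
    rw [map_starOp hZ]
    have hr := map_mem_weightSeries (NF.lift hZ ![f a, f b]) (QuotientGroup.eq.mp h)
    have hbot : weightSeries (Multiplicative ℤ) 2 = ⊥ :=
      nilpotentClassLE_one_of_commGroup (Multiplicative ℤ)
    rw [hbot, mem_bot, map_mul, map_inv, inv_mul_eq_one] at hr
    rw [hr]
    simp [NF.lift_gen]
  have key : ∀ a, f e ^ α * f a ^ β = f a ∧ f a ^ α * f e ^ β = f a := fun a => by
    rw [← hf, ← hf, (he a).1, (he a).2]
    exact ⟨rfl, rfl⟩
  have h1 := key 1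
  have hx := key (gen 2 d 0)
  rw [map_one, one_zpow, one_zpow, mul_one, one_mul] at h1
  rw [h1.1, h1.2, one_mul, mul_one, hfx, ← ofAdd_zsmul, ← ofAdd_zsmul] at hx
  have hβ : β = 1 := by simpa using congrArg Multiplicative.toAdd hx.1
  have hα : α = 1 := by simpa using congrArg Multiplicative.toAdd hx.2
  rw [h, hα, hβ, zpow_one, zpow_one]

/-- On two letters the only standard bracketing of weight two is that of 01, so γ_2/γ_3 is cyclic.
-/
theorem exists_commutator_zpow_mul {r : NF 2 d} (hr : r ∈ weightSeries (NF 2 d) 2) :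
    ∃ k : ℤ, ∃ s ∈ weightSeries (NF 2 d) 3, r = ⁅gen 2 d 0, gen 2 d 1⁆ ^ k * s := by
  rw [← FreeMagma.stdSpan_eq_weightSeries (gen 2 d) (closure_range_gen 2 d) one_le_two] at hr
  have hle : FreeMagma.stdSpan (gen 2 d) 2 (fun _ => True) ≤
      zpowers ⁅gen 2 d 0, gen 2 d 1⁆ ⊔ weightSeries (NF 2 d) 3 := by
    refine sup_le_sup_right ((closure_le _).mpr ?_) _
    rintro _ ⟨t, ht, htn, -, rfl⟩
    cases t with
    | of i => simp at htn
    | mul p q =>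
      rw [FreeMagma.word_mul, List.length_append] at htn
      have hp := p.word_length_pos
      have hq := q.word_length_pos
      cases p with
      | mul p p' =>
        have h1 := p.word_length_pos
        have h2 := p'.word_length_pos
        rw [FreeMagma.word_mul, List.length_append] at htn
        omega
      | of i =>
        cases q with
        | mul q q' =>
          have h1 := q.word_length_pos
          have h2 := q'.word_length_pos
          simp only [FreeMagma.word_mul, FreeMagma.word_of, List.length_append,
            List.length_singleton] at htn
          omega
        | of j =>
          have hij : i < j := by
            have := ht.lt
            simpa [List.cons_lt_cons_iff] using this
          obtain ⟨rfl, rfl⟩ : i = 0 ∧ j = 1 := by omega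
          exact mem_zpowers _
  obtain ⟨_, ⟨k, rfl⟩, s, hs, rfl⟩ := mem_sup_of_normal_right.mp (hle hr)
  exact ⟨k, s, hs, rfl⟩

/-- If `x y [x, y] ^ k s`, with `s` in `γ_3`, fulfills the condition `Op^d`, then `k` is `0` or
`-1`. -/
theorem ConditionOp.exponent_eq (hd : 2 ≤ d) {k : ℤ} {s : NF 2 d}
    (hs : s ∈ weightSeries (NF 2 d) 3)
    (hw : ConditionOp d (gen 2 d 0 * gen 2 d 1 * (⁅gen 2 d 0, gen 2 d 1⁆ ^ k * s))) :
    k = 0 ∨ k = -1 := by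
  obtain ⟨σ, hσ, hσx, hσy⟩ := hw.exists_iso
  have hH := Heisenberg.nilpotentClassLE_two.mono hd
  let φ : NF 2 d →* Heisenberg := NF.lift hH ![⟨1, 0, 0⟩, ⟨0, 1, 0⟩]
  have hφx : φ (gen 2 d 0) = ⟨1, 0, 0⟩ := NF.lift_gen _ _ _
  have hφy : φ (gen 2 d 1) = ⟨0, 1, 0⟩ := NF.lift_gen _ _ _
  have hmul : ∀ g h, φ (σ (g * h)) = φ (σ g) * φ (σ h) *
      ⟨0, 0, k * ((φ (σ g)).a * (φ (σ h)).b - (φ (σ h)).a * (φ (σ g)).b)⟩ := by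
    intro g h
    have hs1 : NF.lift hH ![φ (σ g), φ (σ h)] s = 1 := by
      have := map_mem_weightSeries (NF.lift hH ![φ (σ g), φ (σ h)]) hs
      rwa [show weightSeries Heisenberg 3 = ⊥ from Heisenberg.nilpotentClassLE_two,
        mem_bot] at this
    rw [hσ, map_starOp hH]
    simp only [map_mul, map_zpow, map_commutatorElement, hs1, NF.lift_gen, mul_one,
      Matrix.cons_val_zero, Matrix.cons_val_one, Heisenberg.commutator_eq, Heisenberg.central_zpow]
  -- The coefficient k + 1 cancels the term in a(g) b(h); what remains is -(2k + 1) a(h) b(g), so F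
  -- is additive modulo 2k + 1.
  let F : NF 2 d → ℤ := fun g => (φ (σ g)).c - (k + 1) * ((φ (σ g)).a * (φ (σ g)).b)
  have hF : ∀ g h, 2 * k + 1 ∣ F (g * h) - F g - F h := by
    intro g h
    refine ⟨-((φ (σ h)).a * (φ (σ g)).b), ?_⟩
    simp only [F, hmul, Heisenberg.mul_a, Heisenberg.mul_b, Heisenberg.mul_c]
    ring
  have hdvd : ∀ g, 2 * k + 1 ∣ F g := by
    have h1 : 2 * k + 1 ∣ F 1 := by
      have := hF 1 1
      rwa [mul_one, sub_self, zero_sub, dvd_neg] at this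
    intro g
    have hg : g ∈ closure (Set.range (gen 2 d)) := closure_range_gen 2 d ▸ mem_top g
    induction hg using closure_induction with
    | mem x hx =>
      obtain ⟨j, rfl⟩ := hx
      fin_cases j
      · simp [F, hσx, hφx]
      · simp [F, hσy, hφy]
    | one => exact h1
    | mul x y _ _ hx hy =>
      have := dvd_add (dvd_add (hF x y) hx) hy
      rwa [show F (x * y) - F x - F y + F x + F y = F (x * y) by ring] at this
    | inv x _ hx =>
      have h2 := hF x x⁻¹
      rw [mul_inv_cancel] at h2
      have := dvd_sub (dvd_sub h1 h2) hx
      rwa [show F 1 - (F 1 - F x - F x⁻¹) - F x = F x⁻¹ by ring] at this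
  -- Surjectivity of σ enters here: F takes the value 1 at this element.
  have h1 := hdvd (σ.symm ⁅gen 2 d 0, gen 2 d 1⁆)
  simp only [F, Equiv.apply_symm_apply, map_commutatorElement, hφx, hφy,
    Heisenberg.commutator_eq] at h1
  have h2 : IsUnit (2 * k + 1) := isUnit_of_dvd_one (by simpa using h1)
  rcases Int.isUnit_iff.mp h2 with h | h <;> omega

/-- A word that fulfills the condition `Op^d` is `x y` or `y x`. -/
theorem ConditionOp.eq_or_eq (hd : 2 ≤ d) {w : NF 2 d} (hw : ConditionOp d w) :
    w = gen 2 d 0 * gen 2 d 1 ∨ w = gen 2 d 1 * gen 2 d 0 := by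
  have hassoc := hw.isGroup.assoc
  obtain ⟨e, he, -⟩ := hw.isGroup.exists_unit_inv
  obtain ⟨r, hr, rfl⟩ : ∃ r ∈ weightSeries (NF 2 d) 2, w = gen 2 d 0 * gen 2 d 1 * r :=
    ⟨_, QuotientGroup.eq.mp (mk_eq_of_neutral (by omega) he).symm, by group⟩
  obtain ⟨k, s, hs, rfl⟩ := exists_commutator_zpow_mul hr
  have mk_s : ∀ s ∈ weightSeries (NF 2 d) 3, (s : NF 2 d ⧸ weightSeries (NF 2 d) 3) = 1 :=
    fun s hs => (QuotientGroup.eq_one_iff s).mpr hs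
  rcases hw.exponent_eq hd hs with rfl | rfl
  · left
    refine eq_gen_mul_gen_of_assoc ?_ hassoc
    rw [zpow_zero, one_mul, QuotientGroup.mk_mul, mk_s s hs, mul_one]
  · right
    generalize hw' : gen 2 d 0 * gen 2 d 1 * (⁅gen 2 d 0, gen 2 d 1⁆ ^ (-1 : ℤ) * s) = w at *
    have hswap := starOp_starOp_swap w
    -- Modulo γ_3, w(y, x) = y x [y, x]⁻¹ = [x, y] y x = x y, so the case k = 0 applies to the
    -- opposite operation.
    have hv : starOp w (gen 2 d 1) (gen 2 d 0) = gen 2 d 0 * gen 2 d 1 := by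
      refine eq_gen_mul_gen_of_assoc ?_ fun a b e => ?_
      · have hcomm := commute_mk_of_mem_weightSeries (n := 2)
          (commutator_mem_weightSeries (m := 1) (n := 1) (mem_top (gen 2 d 0)) (mem_top (gen 2 d 1)))
          (gen 2 d 1 * gen 2 d 0)
        rw [← hw', starOp_eq]
        simp only [map_mul, map_zpow, map_commutatorElement, evalHom_gen_zero, evalHom_gen_one]
        rw [zpow_neg_one, commutatorElement_inv, ← mul_assoc, QuotientGroup.mk_mul,
          mk_s _ (map_mem_weightSeries _ hs), mul_one, QuotientGroup.mk_mul, hcomm.eq,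
          ← QuotientGroup.mk_mul]
        simp [commutatorElement_def, mul_assoc]
      · simp only [hswap]
        exact (hassoc e b a).symm
    rw [← starOp_gen w, ← hswap, hv, starOp_eq, map_mul, evalHom_gen_zero, evalHom_gen_one]

theorem conditionOp_gen_mul_gen (d : ℕ) : ConditionOp d (gen 2 d 0 * gen 2 d 1) := by
  have h : ∀ a b, starOp (gen 2 d 0 * gen 2 d 1) a b = a * b := fun a b => by
    rw [starOp_eq, map_mul, evalHom_gen_zero, evalHom_gen_one]
  refine ⟨⟨fun a b c => ?_, 1, fun a => ?_, fun a => ⟨a⁻¹, ?_⟩⟩, Equiv.refl _, fun a b => ?_, rfl,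
    rfl⟩
  · simp only [h, mul_assoc]
  · simp [h]
  · simp [h]
  · simp [h]

/-- The isomorphism inverts the image under the automorphism x ↦ x⁻¹, y ↦ y⁻¹: inversion reverses
products, and the two inversions cancel on the generators. -/
theorem conditionOp_gen_mul_gen_swap (d : ℕ) : ConditionOp d (gen 2 d 1 * gen 2 d 0) := by
  have h : ∀ a b, starOp (gen 2 d 1 * gen 2 d 0) a b = b * a := fun a b => by
    rw [starOp_eq, map_mul, evalHom_gen_zero, evalHom_gen_one]
  let ι : NF 2 d →* NF 2 d := evalHom (gen 2 d 0)⁻¹ (gen 2 d 1)⁻¹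
  have hι : ∀ g, ι (ι g) = g := by
    refine DFunLike.congr_fun (f := ι.comp ι) (g := MonoidHom.id _) (NF.hom_ext fun k => ?_)
    fin_cases k <;> simp [ι]
  refine ⟨⟨fun a b c => ?_, 1, fun a => ?_, fun a => ⟨a⁻¹, ?_⟩⟩,
    ⟨fun g => (ι g)⁻¹, fun g => (ι g)⁻¹, fun g => ?_, fun g => ?_⟩, fun a b => ?_, ?_, ?_⟩
  · simp only [h, mul_assoc]
  · simp [h]
  · simp [h]
  · simp [hι]
  · simp [hι]
  · simp [h]
  · simp [ι]
  · simp [ι]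

theorem gen_mul_gen_ne (hd : 2 ≤ d) : gen 2 d 0 * gen 2 d 1 ≠ gen 2 d 1 * gen 2 d 0 := by
  intro h
  have := congrArg (fun g => (NF.lift (Heisenberg.nilpotentClassLE_two.mono hd)
    ![⟨1, 0, 0⟩, ⟨0, 1, 0⟩] g).c) h
  simp [NF.lift_gen] at this

end StarOp

theorem lemma2 (d : ℕ) (hd : 2 ≤ d) :
    (∀ w : NF 2 d, ConditionOp d w ↔
      w = NF.gen 2 d 0 * NF.gen 2 d 1 ∨ w = NF.gen 2 d 1 * NF.gen 2 d 0) ∧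
    NF.gen 2 d 0 * NF.gen 2 d 1 ≠ NF.gen 2 d 1 * NF.gen 2 d 0 := by
  refine ⟨fun w => ⟨fun hw => hw.eq_or_eq hd, ?_⟩, gen_mul_gen_ne hd⟩
  rintro (rfl | rfl)
  · exact conditionOp_gen_mul_gen d
  · exact conditionOp_gen_mul_gen_swap d
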